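/- Consider either the radial case, $\mathbf D=\mathbb D$ (unit disk), $\mathfrak z=1$, with target point $\mathfrak w=0$ and $\Phi(z)=z$, or the chordal case, $\mathbf D=\mathbb H$ (upper half-plane), $\mathfrak z=0$, with target point $\mathfrak w=\infty$ and $\Phi(z)=\frac{2\mathrm i-z}{2\mathrm i+z}$ (the Möbius map $\mathbb H\to\mathbb D$ with $0\mapsto1$, $2\mathrm i\mapsto0$). Let $\overline{\mathbf D}$ be the Euclidean closure of $\mathbf D$ in $\mathbb C$ and $d_{\mathbf D}(z,w)=|\Phi(z)-\Phi(w)|$. A hull is a compact set $K\subset\overline{\mathbf D}$ with $\mathfrak z\in K$, $\mathfrak w\notin K$, and $\mathbf D\smallsetminus K$ simply connected. Its mapping-out function is the conformal bijection $g_K\colon\mathbf D\smallsetminus K\to\mathbf D$ with $g_K(0)=0$, $g_K'(0)>0$ (radial), resp. $g_K(z)-z\to0$ as $|z|\to\infty$ (chordal). The hull has capacity $T\ge 0$ if $1/g_K'(0)=e^{-T}$ (radial), resp. $\lim_{|z|\to\infty}z(g_K(z)-z)=2T$ (chordal). For $0\le T<\infty$, let $\mathcal X_T$ be the set of continuous injective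 curves $\gamma\colon[0,T]\to\overline{\mathbf D}$ with $\gamma(0)=\mathfrak z$, which may touch $\partial\mathbf D$ only at their endpoints, such that $\gamma[0,t]$ is a hull of capacity $t$ for every $t\in[0,T]$. For continuous curves $\gamma\colon[0,T]\to\overline{\mathbf D}$ and $\tilde\gamma\colon[0,\tilde T]\to\overline{\mathbf D}$, put $$d_{\mathcal X}(\gamma,\tilde\gamma)=\sup_{t\ge0}d_{\mathbf D}\big(\gamma(t\wedge T),\tilde\gamma(t\wedge\tilde T)\big),\qquad d^E_{\mathcal X}(\gamma,\tilde\gamma)=\sup_{t\ge0}\big|\gamma(t\wedge T)-\tilde\gamma(t\wedge\tilde T)\big|,$$ $$d^\circ_{\mathcal X}(\gamma,\tilde\gamma)=\inf_\sigma\sup_{s\in[0,1]}d_{\mathbf D}\big(\gamma(sT),\tilde\gamma(\sigma(s)\tilde T)\big),$$ where the infimum is over all increasing homeomorphisms $\sigma$ of $[0,1]$ (for $T,\tilde T>0$ this is the same as the infimum of $\sup_{t\in[0,T]}d_{\mathbf D}(\gamma(t),\tilde\gamma(\sigma(t)))$ over all increasing homeomorphisms $\sigma\colon[0,T]\to[0,\tilde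 T]$). Let $\overline{\mathcal X}_T$ be the closure of $\mathcal X_T$ with respect to $d_{\mathcal X}$ in the set of continuous curves $[0,T]\to\overline{\mathbf D}$, and $\overline{\mathcal X}_{<\infty}=\bigcup_{T<\infty}\overline{\mathcal X}_T$. Then, in both cases, $d_{\mathcal X}$, $d^E_{\mathcal X}$ and $d^\circ_{\mathcal X}$ are (finite) metrics on $\overline{\mathcal X}_{<\infty}$, and they induce the same topology on it. -/

import Mathlib

open scoped NNReal ENNReal Topology

/-- The two reference settings: radial curves in the unit disk from `1` towards `0`, and chordal
curves in the upper half-plane from `0` towards `∞`. -/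
inductive LoewnerCase where
  | radial
  | chordal

namespace LoewnerCase

/-- The reference domain: the open unit disk, respectively the open upper half-plane. -/
def domain : LoewnerCase → Set ℂ
  | radial => Metric.ball 0 1
  | chordal => {z : ℂ | 0 < z.im}

/-- The initial point: `1`, respectively `0`. -/
def start : LoewnerCase → ℂ
  | radial => 1
  | chordal => 0

/-- The uniformizing map to the unit disk: the identity, respectively the Möbius map sending the
upper half-plane onto the disk with `0 ↦ 1` and `2i ↦ 0`. It is defined on the closed domain. -/
noncomputable def unif : LoewnerCase → ℂ → ℂ
  | radial => fun z => z
  | chordal => fun z => (2 * Complex.I - z) / (2 * Complex.I + z)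

/-- The set avoids the target point (`0`, respectively `∞`). Compact sets always avoid `∞`. -/
def AvoidsTarget : LoewnerCase → Set ℂ → Prop
  | radial => fun K => (0 : ℂ) ∉ K
  | chordal => fun _ => True

/-- Hulls which contain the initial point and not the target point. -/
structure IsHull (c : LoewnerCase) (K : Set ℂ) : Prop where
  isCompact : IsCompact K
  subset_closure : K ⊆ closure c.domain
  simplyConnected : IsSimplyConnected (c.domain \ K)
  start_mem : c.start ∈ K
  avoidsTarget : c.AvoidsTarget K

/-- `g` maps `U` conformally (biholomorphically) onto `V`. -/
def IsConformalOnto (g : ℂ → ℂ) (U V : Set ℂ) : Prop :=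
  DifferentiableOn ℂ g U ∧ Set.BijOn g U V

/-- The normalization of the mapping-out function of `K`: `g(0) = 0` and `g'(0) > 0` in the radial
case, and `g(z) - z → 0` as `|z| → ∞` in the chordal case. -/
def IsNormalized : LoewnerCase → (ℂ → ℂ) → Set ℂ → Prop
  | radial => fun g _ => g 0 = 0 ∧ ∃ a : ℝ, 0 < a ∧ deriv g 0 = (a : ℂ)
  | chordal => fun g K =>
      Filter.Tendsto (fun z => g z - z)
        (Bornology.cobounded ℂ ⊓ Filter.principal (chordal.domain \ K)) (𝓝 0)

/-- `g` is the mapping-out function of `K`. -/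
def IsMappingOut (c : LoewnerCase) (K : Set ℂ) (g : ℂ → ℂ) : Prop :=
  IsConformalOnto g (c.domain \ K) c.domain ∧ c.IsNormalized g K

/-- The capacity read off a mapping-out function is `T`: the conformal radius `1 / g'(0)` equals
`exp (-T)` in the radial case, and the half-plane capacity `lim z (g(z) - z)` equals `2 T` in the
chordal case. -/
def MappingOutCapacity : LoewnerCase → (ℂ → ℂ) → Set ℂ → ℝ≥0 → Prop
  | radial => fun g _ T => (deriv g 0)⁻¹ = ((Real.exp (-(T : ℝ)) : ℝ) : ℂ)
  | chordal => fun g K T =>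
      Filter.Tendsto (fun z => z * (g z - z))
        (Bornology.cobounded ℂ ⊓ Filter.principal (chordal.domain \ K)) (𝓝 (2 * ((T : ℝ) : ℂ)))

/-- `K` is a hull of capacity `T`. -/
def IsHullOfCapacity (c : LoewnerCase) (K : Set ℂ) (T : ℝ≥0) : Prop :=
  c.IsHull K ∧ ∃ g : ℂ → ℂ, c.IsMappingOut K g ∧ c.MappingOutCapacity g K T

end LoewnerCase

/-- Continuous curves `[0, T] → closure of the domain` with `T < ∞` the `duration`. The path is
extended to all times `t ≥ 0` by its value at `T`, so that `path t` stands for `γ (t ∧ T)`. The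
closure is the Euclidean one, so that curves in the half-plane do not pass through `∞`. -/
@[ext]
structure LoewnerCurve (c : LoewnerCase) where
  duration : ℝ≥0
  path : ℝ≥0 → ℂ
  continuous_path : Continuous path
  path_mem : ∀ t, path t ∈ closure c.domain
  stopped : ∀ t, duration ≤ t → path t = path duration

namespace LoewnerCurve

variable {c : LoewnerCase}

/-- The capacity-parameterized metric: `sup_t |Φ(γ(t ∧ T)) - Φ(η(t ∧ S))|`, with `Φ` the
uniformizing map to the disk. -/
noncomputable def distCap (γ η : LoewnerCurve c) : ℝ≥0∞ :=
  ⨆ t : ℝ≥0, edist (c.unif (γ.path t)) (c.unif (η.path t))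

/-- The Euclidean sup metric: `sup_t |γ(t ∧ T) - η(t ∧ S)|`. -/
noncomputable def distEucl (γ η : LoewnerCurve c) : ℝ≥0∞ :=
  ⨆ t : ℝ≥0, edist (γ.path t) (η.path t)

/-- The unparameterized metric. Both parameter intervals are rescaled affinely to `[0, 1]`, and
the infimum is over all increasing homeomorphisms of `[0, 1]`; for positive durations `T`, `S` this
is the infimum over all increasing homeomorphisms `[0, T] → [0, S]`, see
`distUnparam_eq_iInf_orderIso`. The rescaling also covers one-point curves (duration `0`). -/
noncomputable def distUnparam (γ η : LoewnerCurve c) : ℝ≥0∞ :=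
  ⨅ σ : Set.Icc (0 : ℝ≥0) 1 ≃o Set.Icc (0 : ℝ≥0) 1, ⨆ s : Set.Icc (0 : ℝ≥0) 1,
    edist (c.unif (γ.path (s * γ.duration))) (c.unif (η.path (σ s * η.duration)))

/-- The affine increasing homeomorphism from `[0, 1]` onto `[0, T]`. -/
noncomputable def scaleIso (T : ℝ≥0) (hT : 0 < T) :
    Set.Icc (0 : ℝ≥0) 1 ≃o Set.Icc (0 : ℝ≥0) T where
  toFun s := ⟨s * T, zero_le, mul_le_of_le_one_left zero_le s.2.2⟩
  invFun t := ⟨t / T, zero_le, div_le_one_of_le₀ t.2.2 zero_le⟩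
  left_inv s := Subtype.ext (mul_div_cancel_right₀ _ hT.ne')
  right_inv t := Subtype.ext (div_mul_cancel₀ _ hT.ne')
  map_rel_iff' := by
    intro a b
    change (a : ℝ≥0) * T ≤ b * T ↔ a ≤ b
    rw [mul_le_mul_iff_left₀ hT]
    rfl

theorem distUnparam_eq_iInf_orderIso (γ η : LoewnerCurve c)
    (hγ : 0 < γ.duration) (hη : 0 < η.duration) :
    distUnparam γ η =
      ⨅ σ : Set.Icc (0 : ℝ≥0) γ.duration ≃o Set.Icc (0 : ℝ≥0) η.duration,
        ⨆ t : Set.Icc (0 : ℝ≥0) γ.duration,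
          edist (c.unif (γ.path t)) (c.unif (η.path (σ t))) := by
  apply le_antisymm
  · refine le_iInf fun σ => ?_
    refine (iInf_le _ (((scaleIso _ hγ).trans σ).trans (scaleIso _ hη).symm)).trans ?_
    refine iSup_le fun s => ?_
    refine le_trans (le_of_eq ?_) (le_iSup _ (scaleIso _ hγ s))
    have h : ((scaleIso _ hη).symm (σ (scaleIso _ hγ s)) : ℝ≥0) * η.duration
        = (σ (scaleIso _ hγ s) : ℝ≥0) :=
      congrArg Subtype.val ((scaleIso _ hη).apply_symm_apply (σ (scaleIso _ hγ s)))
    simp only [OrderIso.trans_apply]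
    rw [h]
    rfl
  · refine le_iInf fun σ => ?_
    refine (iInf_le _ (((scaleIso _ hγ).symm.trans σ).trans (scaleIso _ hη))).trans ?_
    refine iSup_le fun t => ?_
    refine le_trans (le_of_eq ?_) (le_iSup _ ((scaleIso _ hγ).symm t))
    have h : ((scaleIso _ hγ).symm t : ℝ≥0) * γ.duration = (t : ℝ≥0) :=
      congrArg Subtype.val ((scaleIso _ hγ).apply_symm_apply t)
    simp only [OrderIso.trans_apply]
    rw [h]
    rfl

theorem distUnparam_comm_le (γ η : LoewnerCurve c) : distUnparam γ η ≤ distUnparam η γ := by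
  refine le_iInf fun σ => (iInf_le _ σ.symm).trans (iSup_le fun s => ?_)
  refine le_trans (le_of_eq ?_) (le_iSup _ (σ.symm s))
  simp only [OrderIso.apply_symm_apply]
  exact edist_comm _ _

theorem distUnparam_triangle (γ η ξ : LoewnerCurve c) :
    distUnparam γ ξ ≤ distUnparam γ η + distUnparam η ξ := by
  simp only [distUnparam, ENNReal.iInf_add, ENNReal.add_iInf]
  refine le_iInf fun σ => le_iInf fun τ => ?_
  refine (iInf_le _ (τ.trans σ)).trans (iSup_le fun s => ?_)
  refine (edist_triangle _ (c.unif (η.path (τ s * η.duration))) _).trans ?_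
  refine add_le_add ?_ ?_
  · exact le_iSup (fun s : Set.Icc (0 : ℝ≥0) 1 =>
      edist (c.unif (γ.path (s * γ.duration))) (c.unif (η.path (τ s * η.duration)))) s
  · exact le_iSup (fun s : Set.Icc (0 : ℝ≥0) 1 =>
      edist (c.unif (η.path (s * η.duration))) (c.unif (ξ.path (σ s * ξ.duration)))) (τ s)

/-- `γ` is a simple curve of capacity `duration`, parameterized by capacity: it is injective on
`[0, T]`, touches the boundary of the domain at most at its endpoints, starts from the initial
point, and `γ[0, t]` is a hull of capacity `t` for all `t ≤ T`. -/
structure IsSimpleCapacityCurve (γ : LoewnerCurve c) : Prop where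
  injOn : Set.InjOn γ.path (Set.Icc 0 γ.duration)
  mem_domain : ∀ t ∈ Set.Ioo 0 γ.duration, γ.path t ∈ c.domain
  path_zero : γ.path 0 = c.start
  hull : ∀ t ∈ Set.Icc 0 γ.duration, c.IsHullOfCapacity (γ.path '' Set.Icc 0 t) t

/-- `γ` belongs to the closure, in the capacity-parameterized metric, of the simple curves of
capacity `T` within the continuous curves on `[0, T]`. -/
def MemClosure (γ : LoewnerCurve c) (T : ℝ≥0) : Prop :=
  γ.duration = T ∧ ∀ ε : ℝ≥0∞, 0 < ε →
    ∃ η : LoewnerCurve c, η.IsSimpleCapacityCurve ∧ η.duration = T ∧ distCap γ η < ε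

end LoewnerCurve

open LoewnerCurve in
/-- The space of finite-capacity curves: the union over `T < ∞` of the closures of the simple
curves of capacity `T`. -/
def FiniteCapacityCurve (c : LoewnerCase) : Type :=
  {γ : LoewnerCurve c // ∃ T : ℝ≥0, γ.MemClosure T}

namespace FiniteCapacityCurve

/-- The capacity-parameterized metric on the finite-capacity curves. -/
@[reducible]
noncomputable def capMetric (c : LoewnerCase) : PseudoEMetricSpace (FiniteCapacityCurve c) where
  edist γ η := LoewnerCurve.distCap γ.1 η.1
  edist_self γ := by simp [LoewnerCurve.distCap]
  edist_comm γ η := by simp only [LoewnerCurve.distCap, edist_comm]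
  edist_triangle γ η ξ := by
    refine iSup_le fun t => (edist_triangle _ (c.unif (η.1.path t)) _).trans ?_
    exact add_le_add
      (le_iSup (fun t => edist (c.unif (γ.1.path t)) (c.unif (η.1.path t))) t)
      (le_iSup (fun t => edist (c.unif (η.1.path t)) (c.unif (ξ.1.path t))) t)

/-- The Euclidean sup metric on the finite-capacity curves. -/
@[reducible]
noncomputable def euclMetric (c : LoewnerCase) : PseudoEMetricSpace (FiniteCapacityCurve c) where
  edist γ η := LoewnerCurve.distEucl γ.1 η.1
  edist_self γ := by simp [LoewnerCurve.distEucl]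
  edist_comm γ η := by simp only [LoewnerCurve.distEucl, edist_comm]
  edist_triangle γ η ξ := by
    refine iSup_le fun t => (edist_triangle _ (η.1.path t) _).trans ?_
    exact add_le_add
      (le_iSup (fun t => edist (γ.1.path t) (η.1.path t)) t)
      (le_iSup (fun t => edist (η.1.path t) (ξ.1.path t)) t)

/-- The unparameterized metric on the finite-capacity curves. -/
@[reducible]
noncomputable def unparamMetric (c : LoewnerCase) :
    PseudoEMetricSpace (FiniteCapacityCurve c) where
  edist γ η := LoewnerCurve.distUnparam γ.1 η.1
  edist_self γ := by
    refine le_antisymm ((iInf_le _ (OrderIso.refl _)).trans (iSup_le fun s => ?_)) zero_le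
    exact (edist_self _).le
  edist_comm γ η :=
    le_antisymm (LoewnerCurve.distUnparam_comm_le _ _) (LoewnerCurve.distUnparam_comm_le _ _)
  edist_triangle γ η ξ := LoewnerCurve.distUnparam_triangle _ _ _

/-- The topology whose open sets are generated by the balls of `m`. -/
@[reducible]
def topologyOf {X : Type} (m : PseudoEMetricSpace X) : TopologicalSpace X :=
  m.toUniformSpace.toTopologicalSpace

/-- `m` is a genuine metric: distances are finite, and distinct points have positive distance. -/
def IsGenuineMetric {X : Type} (m : PseudoEMetricSpace X) : Prop :=
  ∀ x y : X, m.edist x y ≠ ⊤ ∧ (m.edist x y = 0 → x = y)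

end FiniteCapacityCurve

/-! On the closed domain `Φ` is 1-Lipschitz, so `distCap ≤ distEucl`, and a nearly optimal change of
time gives `distUnparam ≤ distCap`. Since a given curve `γ` is bounded, and `Φ⁻¹` has a modulus of
continuity at bounded sets, the first inequality can be reversed locally around `γ`.

The substance is the local reversal of the second one (`MemClosure.exists_distCap_le`). A
reparameterization that matches two curves also matches their initial segments, which are then
Hausdorff close. As time is capacity, it suffices that capacity is continuous for the Hausdorff
distance, uniformly on bounded families of hulls (`exists_abs_capacity_sub_le`): matched times are
then close, and uniform continuity of `γ` finishes. The same fact recovers the duration of a curve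
from its stopped path, hence definiteness.

For capacity, let `K` lie in a small neighbourhood of `L`, with mapping-out functions `k` and `g`. A
weak Koebe theorem, integrated along a segment by Grönwall, shows that `g` is close to the boundary
near `L`, hence near `K` (`radial_near_hull`, `chordal_near_hull`). The maximum principle on the
complement of `K ∪ L`, applied to `k / g` or to `Im (g - k)` plus a correction, compares the two
capacities. -/

open Set Filter Metric

/-! ### Holomorphic inverses and a weak Koebe theorem. -/

/-- The inverse of a holomorphic bijection between open sets is holomorphic. -/
theorem exists_holomorphic_inverse {g : ℂ → ℂ} {U V : Set ℂ} (hU : IsOpen U)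
    (hg : DifferentiableOn ℂ g U) (hb : BijOn g U V) :
    ∃ f : ℂ → ℂ, DifferentiableOn ℂ f V ∧ InvOn f g U V ∧ MapsTo f V U := by
  obtain ⟨hmaps, hinj, hsurj⟩ := hb
  refine ⟨Function.invFunOn g U, ?_, ⟨hinj.leftInvOn_invFunOn, hsurj.rightInvOn_invFunOn⟩,
    hsurj.mapsTo_invFunOn⟩
  set f := Function.invFunOn g U
  have hfg : LeftInvOn f g U := hinj.leftInvOn_invFunOn
  have han : AnalyticOnNhd ℂ g U := hg.analyticOnNhd hU
  have hopen : ∀ z ∈ U, 𝓝 (g z) ≤ map g (𝓝 z) := by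
    intro z hz
    refine (han z hz).eventually_constant_or_nhds_le_map_nhds.resolve_left fun hc => ?_
    have h1 : ∀ᶠ y in 𝓝[≠] z, g y = g z ∧ y ∈ U :=
      (hc.and (hU.mem_nhds hz)).filter_mono nhdsWithin_le_nhds
    obtain ⟨y, ⟨hy, hyU⟩, hne⟩ := (h1.and self_mem_nhdsWithin).exists
    exact hne (hinj hyU hz hy)
  have hcont : ∀ z ∈ U, ContinuousAt f (g z) := by
    intro z hz
    have h1 : Tendsto (f ∘ g) (𝓝 z) (𝓝 z) :=
      tendsto_id.congr' (by filter_upwards [hU.mem_nhds hz] with y hy using (hfg hy).symm)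
    have h2 : Tendsto f (𝓝 (g z)) (𝓝 z) := (tendsto_map'_iff.2 h1).mono_left (hopen z hz)
    rwa [ContinuousAt, hfg hz]
  have hVnhds : ∀ z ∈ U, V ∈ 𝓝 (g z) := fun z hz =>
    mem_of_superset (hopen z hz (image_mem_map (hU.mem_nhds hz))) (image_subset_iff.2 hmaps)
  have hgf : RightInvOn f g V := hsurj.rightInvOn_invFunOn
  have hdiff : ∀ z ∈ U, deriv g z ≠ 0 → DifferentiableAt ℂ f (g z) := by
    intro z hz hne
    have hd : HasDerivAt g (deriv g z) (f (g z)) := by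
      rw [hfg hz]; exact (hg.differentiableAt (hU.mem_nhds hz)).hasDerivAt
    exact (hd.of_local_left_inverse (hcont z hz) hne
      (by filter_upwards [hVnhds z hz] with y hy using hgf hy)).differentiableAt
  intro w hw
  obtain ⟨z, hz, rfl⟩ := hsurj hw
  refine DifferentiableAt.differentiableWithinAt ?_
  -- Critical points of `g` are isolated, so `f` is continuous at `g z` and holomorphic on a
  -- punctured neighbourhood: the singularity is removable.
  refine (Complex.analyticAt_of_differentiable_on_punctured_nhds_of_continuousAt ?_
    (hcont z hz)).differentiableAt
  have hder : ∀ᶠ y in 𝓝[≠] z, deriv g y ≠ 0 := by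
    refine (han z hz).deriv.eventually_eq_zero_or_eventually_ne_zero.resolve_left fun hc => ?_
    obtain ⟨r, hr, hball⟩ := Metric.eventually_nhds_iff_ball.1 (hc.and (hU.mem_nhds hz))
    have hconst : ∀ y ∈ ball z r, g y = g z := fun y hy =>
      (convex_ball z r).is_const_of_fderivWithin_eq_zero (𝕜 := ℂ)
        (hg.mono fun y hy => (hball y hy).2) (fun x hx => by
          rw [fderivWithin_of_isOpen isOpen_ball hx]
          ext
          simpa using (hball x hx).1) hy (mem_ball_self hr)
    have h1 : ∀ᶠ y in 𝓝[≠] z, y ∈ ball z r :=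
      Filter.Eventually.filter_mono nhdsWithin_le_nhds (ball_mem_nhds z hr)
    obtain ⟨y, hy, hne⟩ := (h1.and self_mem_nhdsWithin).exists
    exact hne (hinj (hball y hy).2 hz (hconst y hy))
  have hf' : Tendsto f (𝓝[≠] (g z)) (𝓝[≠] z) := by
    refine tendsto_nhdsWithin_iff.2 ⟨?_, ?_⟩
    · have := (hcont z hz).tendsto
      rw [hfg hz] at this
      exact this.mono_left nhdsWithin_le_nhds
    · have hV : ∀ᶠ y in 𝓝[≠] (g z), y ∈ V :=
        Filter.Eventually.filter_mono nhdsWithin_le_nhds (hVnhds z hz)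
      filter_upwards [hV, self_mem_nhdsWithin] with y hy hne heq
      exact hne (by rw [mem_singleton_iff, ← hgf hy, mem_singleton_iff.1 heq])
  have hV : ∀ᶠ y in 𝓝[≠] (g z), y ∈ V :=
    Filter.Eventually.filter_mono nhdsWithin_le_nhds (hVnhds z hz)
  filter_upwards [hf'.eventually hder, hV] with y hy hyV
  have := hdiff (f y) (hsurj.mapsTo_invFunOn hyV) hy
  rwa [hgf hyV] at this

/-- A weak form of the Koebe one-quarter theorem, for the distance to the closest omitted point. -/
theorem norm_deriv_le_of_closest_omitted {U : Set ℂ} (hUo : IsOpen U) (hUs : IsSimplyConnected U)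
    {f : ℂ → ℂ} {w : ℂ} {r : ℝ} (hr : 0 < r) (hf : DifferentiableOn ℂ f (ball w r))
    (hm : MapsTo f (ball w r) U) {a : ℂ} (ha : a ∉ U) (hball : ball (f w) (dist (f w) a) ⊆ U) :
    ‖deriv f w‖ ≤ 24 * dist (f w) a / r := by
  have hw : w ∈ ball w r := mem_ball_self hr
  set z₀ := f w with hz₀
  have hz₀U : z₀ ∈ U := hm hw
  have hz₀a : z₀ - a ≠ 0 := sub_ne_zero.2 fun h => ha (h ▸ hz₀U)
  have hpos : 0 < ‖z₀ - a‖ := norm_pos_iff.2 hz₀a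
  -- A square root of `(z - a) / (z₀ - a)` on the simply connected `U` never takes opposite values
  -- at points with different squares; this turns the single omitted point into an omitted disk.
  obtain ⟨s, hsc, hs⟩ := Complex.exists_continuousOn_pow_eq hUs hUo
    (g := fun z => (z - a) / (z₀ - a)) (by fun_prop)
    (by rintro ⟨z, hz, h0⟩
        rcases div_eq_zero_iff.1 h0 with h | h
        · exact ha (sub_eq_zero.1 h ▸ hz)
        · exact hz₀a h) two_ne_zero
  have hs0 : s z₀ ≠ 0 := by
    intro h
    have := hs z₀
    simp [h, div_self hz₀a] at this
  have hs0sq : s z₀ ^ 2 = 1 := by rw [hs, div_self hz₀a]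
  -- on the ball around `z₀`, the branch stays in a half-plane
  have hre : ∀ z ∈ ball z₀ (dist z₀ a), 0 < (s z / s z₀).re := by
    -- The square lies in the unit disk about `1`, so it has positive real part, unlike the square
    -- of an imaginary number.
    have hne : ∀ z ∈ ball z₀ (dist z₀ a), (s z / s z₀).re ≠ 0 := by
      intro z hz h0
      have h1 : (s z / s z₀) ^ 2 = 1 + (z - z₀) / (z₀ - a) := by
        rw [div_pow, hs, hs0sq]; field_simp; ring
      have h2 : ‖(z - z₀) / (z₀ - a)‖ < 1 := by
        rw [norm_div, div_lt_one hpos]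
        simpa [dist_eq_norm] using hz
      have h3 : -‖(z - z₀) / (z₀ - a)‖ ≤ ((z - z₀) / (z₀ - a)).re :=
        (abs_le.1 (Complex.abs_re_le_norm _)).1
      have h4 := congrArg Complex.re h1
      simp only [sq, Complex.mul_re, h0, Complex.add_re, Complex.one_re] at h4
      nlinarith [sq_nonneg (s z / s z₀).im]
    have hcont : ContinuousOn (fun z => (s z / s z₀).re) (ball z₀ (dist z₀ a)) :=
      Complex.continuous_re.comp_continuousOn ((hsc.mono hball).div_const _)
    intro z hz
    by_contra hle
    have hz₀b : z₀ ∈ ball z₀ (dist z₀ a) :=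
      mem_ball_self (by rw [dist_eq_norm]; exact hpos)
    obtain ⟨y, hy, hy0⟩ := (convex_ball z₀ (dist z₀ a)).isPreconnected.intermediate_value hz hz₀b
      hcont (show (0:ℝ) ∈ Icc _ _ from ⟨not_lt.1 hle, by simp [div_self hs0]⟩)
    exact hne y hy hy0
  set h : ℂ → ℂ := fun ζ => s (f ζ) / s z₀ with hh
  have hsq : ∀ ζ, h ζ ^ 2 = (f ζ - a) / (z₀ - a) := by
    intro ζ; simp only [hh, div_pow, hs0sq, hs, div_one]
  have hfc : ContinuousOn h (ball w r) := (hsc.comp hf.continuousOn hm).div_const _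
  have hh0 : ∀ ζ ∈ ball w r, h ζ ≠ 0 := by
    intro ζ hζ h0
    have := hsq ζ
    rw [h0, zero_pow two_ne_zero, eq_comm, div_eq_zero_iff] at this
    exact this.elim (fun h => ha (sub_eq_zero.1 h ▸ hm hζ)) hz₀a
  have hderiv : ∀ ζ ∈ ball w r, HasDerivAt h (deriv f ζ / (z₀ - a) / (2 * h ζ)) ζ := by
    intro ζ hζ
    have hfd := (hf.differentiableAt (isOpen_ball.mem_nhds hζ)).hasDerivAt
    have hq : HasDerivAt (fun ζ => (f ζ - a) / (z₀ - a)) (deriv f ζ / (z₀ - a)) ζ :=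
      (hfd.sub_const a).div_const _
    have hq' : HasDerivAt (fun ζ => h ζ ^ 2) (deriv f ζ / (z₀ - a)) ζ := by
      simpa only [hsq] using hq
    -- The branch is only known to be continuous; dividing the slope of `h ^ 2` by `h y + h ζ` gives
    -- the slope of `h`.
    rw [hasDerivAt_iff_tendsto_slope] at hq' ⊢
    have hca : Tendsto h (𝓝[≠] ζ) (𝓝 (h ζ)) :=
      ((hfc.continuousAt (isOpen_ball.mem_nhds hζ)).tendsto).mono_left nhdsWithin_le_nhds
    have hsum : Tendsto (fun y => h y + h ζ) (𝓝[≠] ζ) (𝓝 (2 * h ζ)) := by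
      rw [two_mul]; exact hca.add_const _
    have h2 : (2 : ℂ) * h ζ ≠ 0 := mul_ne_zero two_ne_zero (hh0 ζ hζ)
    refine (hq'.div hsum h2).congr' ?_
    filter_upwards [hsum.eventually_ne h2] with y hy
    simp only [Pi.div_apply, slope_def_field]
    rw [div_div, mul_comm, ← div_div, sq_sub_sq, mul_div_cancel_left₀ _ hy]
  -- If `h ζ` were within `2/5` of `-1`, its square would be within `(2/5)(12/5) < 1` of `1`,
  -- placing `f ζ` in the ball where the branch has positive real part.
  have homit : ∀ ζ ∈ ball w r, 2 / 5 ≤ ‖h ζ + 1‖ := by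
    intro ζ hζ
    by_contra! hlt
    set t := -h ζ with ht
    have ht1 : ‖t - 1‖ < 2 / 5 := by
      rwa [← norm_neg, show -(t - 1) = h ζ + 1 by rw [ht]; ring]
    have hts : t ^ 2 = (f ζ - a) / (z₀ - a) := by rw [ht, neg_sq, hsq]
    have hmem : f ζ ∈ ball z₀ (dist z₀ a) := by
      have h1 : f ζ - z₀ = (t - 1) * (t + 1) * (z₀ - a) := by
        have : t ^ 2 * (z₀ - a) = f ζ - a := by rw [hts, div_mul_cancel₀ _ hz₀a]
        linear_combination -this
      have h2 : ‖t + 1‖ ≤ ‖t - 1‖ + 2 := by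
        calc ‖t + 1‖ = ‖(t - 1) + 2‖ := by congr 1; ring
          _ ≤ _ := (norm_add_le _ _).trans (by simp)
      rw [mem_ball, dist_eq_norm, dist_eq_norm, h1, norm_mul, norm_mul]
      have h3 : ‖t - 1‖ * ‖t + 1‖ < 1 := by nlinarith [norm_nonneg (t - 1), norm_nonneg (t + 1)]
      nlinarith
    have h1 := hre _ hmem
    have h2 : (t - 1).re ≥ -‖t - 1‖ := (abs_le.1 (Complex.abs_re_le_norm _)).1
    have h3 : t.re = -(s (f ζ) / s z₀).re := by simp [ht, hh]
    simp only [Complex.sub_re, Complex.one_re] at h2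
    linarith
  have hne : ∀ ζ ∈ ball w r, h ζ + 1 ≠ 0 := fun ζ hζ h0 => by
    have := homit ζ hζ
    rw [h0, norm_zero] at this
    norm_num at this
  have hw1 : h w = 1 := by simp only [hh, ← hz₀]; exact div_self hs0
  have hk : DifferentiableOn ℂ (fun ζ => (h ζ + 1)⁻¹) (ball w r) := fun ζ hζ =>
    (((hderiv ζ hζ).differentiableAt.add_const 1).fun_inv (hne ζ hζ)).differentiableWithinAt
  have hkd : deriv (fun ζ => (h ζ + 1)⁻¹) w = -(deriv f w / (z₀ - a) / 2) / 4 := by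
    rw [(((hderiv w hw).add_const 1).fun_inv (hne w hw)).deriv, hw1]
    norm_num
  -- The values have norm at most `5/2` and the central value is `1/2`, whence `3`. The derivative
  -- is that of `f` divided by `-8 (z₀ - a)`, whence `24 = 3 * 8`.
  have hbound : ‖deriv (fun ζ => (h ζ + 1)⁻¹) w‖ ≤ 3 / r := by
    refine Complex.norm_deriv_le_div_of_mapsTo_ball hk (fun ζ hζ => ?_) hr
    have h1 : ‖(h ζ + 1)⁻¹‖ ≤ 5 / 2 := by
      rw [norm_inv]
      exact (inv_anti₀ (by norm_num) (homit ζ hζ)).trans (by norm_num)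
    rw [mem_closedBall, dist_eq_norm, hw1]
    refine (norm_sub_le _ _).trans ?_
    have h2 : ‖((1 : ℂ) + 1)⁻¹‖ = 1 / 2 := by norm_num
    linarith
  rw [hkd] at hbound
  simp only [norm_div, norm_neg, Complex.norm_ofNat] at hbound
  rw [dist_eq_norm, le_div_iff₀ hr]
  rw [le_div_iff₀ hr, div_mul_eq_mul_div, div_le_iff₀ (by norm_num), div_mul_eq_mul_div,
    div_le_iff₀ (by norm_num), div_mul_eq_mul_div, div_le_iff₀ hpos] at hbound
  linarith

/-- A weak form of the Koebe one-quarter theorem. -/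
theorem norm_deriv_le_of_omitted {U : Set ℂ} (hUo : IsOpen U) (hUs : IsSimplyConnected U)
    {f : ℂ → ℂ} {w : ℂ} {r : ℝ} (hr : 0 < r) (hf : DifferentiableOn ℂ f (ball w r))
    (hm : MapsTo f (ball w r) U) {a : ℂ} (ha : a ∉ U) :
    ‖deriv f w‖ ≤ 24 * dist (f w) a / r := by
  obtain ⟨b, hb, hdist⟩ := hUo.isClosed_compl.exists_infDist_eq_dist ⟨a, ha⟩ (f w)
  refine (norm_deriv_le_of_closest_omitted hUo hUs hr hf hm hb ?_).trans ?_
  · rw [← hdist]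
    simpa using ball_infDist_compl_subset (s := U) (x := f w)
  · gcongr
    rw [← hdist]
    exact infDist_le_dist_of_mem ha

/-! ### Grönwall and maximum principles. -/

/-- A Grönwall estimate, backwards in time. -/
theorem norm_le_norm_mul_exp_of_norm_deriv_le {p p' : ℝ → ℂ} {C S : ℝ} (hS : 0 ≤ S)
    (hd : ∀ s ∈ Icc 0 S, HasDerivAt p (p' s) s) (hb : ∀ s ∈ Icc 0 S, ‖p' s‖ ≤ C * ‖p s‖) :
    ‖p 0‖ ≤ ‖p S‖ * Real.exp (C * S) := by
  have hmem : ∀ s ∈ Icc 0 S, S - s ∈ Icc 0 S := fun s hs =>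
    ⟨sub_nonneg.2 hs.2, sub_le_self _ hs.1⟩
  have hq : ∀ s ∈ Icc 0 S, HasDerivAt (fun s => p (S - s)) (-p' (S - s)) s := fun s hs => by
    simpa [Function.comp_def] using
      (hd (S - s) (hmem s hs)).scomp s ((hasDerivAt_id s).const_sub S)
  have := norm_le_gronwallBound_of_norm_deriv_right_le (f := fun s => p (S - s))
    (f' := fun s => -p' (S - s)) (δ := ‖p S‖) (K := C) (ε := 0) (a := 0) (b := S)
    (fun s hs => (hq s hs).continuousAt.continuousWithinAt)
    (fun s hs => (hq s (Ico_subset_Icc_self hs)).hasDerivWithinAt)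
    (by simp) (fun s hs => by simpa using hb (S - s) (hmem s (Ico_subset_Icc_self hs)))
    S ⟨hS, le_rfl⟩
  simpa [gronwallBound_ε0] using this

/-- The maximum principle for the norm of a holomorphic function on an open set. -/
theorem norm_lt_of_eventually_boundary_lt {W : Set ℂ} (hW : IsOpen W) {G : ℂ → ℂ} {c : ℝ}
    (hG : DifferentiableOn ℂ G W) (hb : ∀ z, z ∉ W → ∀ᶠ y in 𝓝[W] z, ‖G y‖ < c)
    (hinf : ∀ᶠ y in Bornology.cobounded ℂ ⊓ 𝓟 W, ‖G y‖ < c) {z : ℂ} (hz : z ∈ W) :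
    ‖G z‖ < c := by
  by_contra! hcz
  -- The boundary conditions, including the one at infinity, make this superlevel set compact.
  set C : Set ℂ := {y | y ∈ W ∧ c ≤ ‖G y‖}
  have hCclosed : IsClosed C := by
    rw [isClosed_iff_frequently]
    intro x hx
    have hxW : x ∈ W := by
      by_contra hxW
      obtain ⟨y, hy, hy'⟩ := (hx.and_eventually (eventually_nhdsWithin_iff.1 (hb x hxW))).exists
      exact (hy' hy.1).not_ge hy.2
    refine ⟨hxW, ?_⟩
    by_contra! hlt
    have := (hG.continuousOn.continuousAt (hW.mem_nhds hxW)).norm.eventually (gt_mem_nhds hlt)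
    obtain ⟨y, hy, hy'⟩ := (hx.and_eventually this).exists
    exact hy'.not_ge hy.2
  have hCbdd : Bornology.IsBounded C := by
    rw [Bornology.isBounded_def]
    filter_upwards [eventually_inf_principal.1 hinf] with y hy hyC
    exact (hy hyC.1).not_ge hyC.2
  have hCcomp : IsCompact C := isCompact_of_isClosed_isBounded hCclosed hCbdd
  obtain ⟨x, hx, hmax⟩ := hCcomp.exists_isMaxOn ⟨z, hz, hcz⟩
    (hG.continuousOn.norm.mono fun y hy => hy.1)
  have hmaxW : ∀ y ∈ W, ‖G y‖ ≤ ‖G x‖ := fun y hy => by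
    by_cases h : c ≤ ‖G y‖
    · exact hmax ⟨hy, h⟩
    · exact (not_le.1 h).le.trans hx.2
  -- `W` may be disconnected, so the contradiction comes from the plane: the set of maximum points
  -- is clopen, nonempty and compact in `ℂ`.
  set M : Set ℂ := {y | y ∈ C ∧ ‖G y‖ = ‖G x‖}
  have hMclosed : IsClosed M := by
    have := (hG.continuousOn.norm.mono fun y (hy : y ∈ C) => hy.1).preimage_isClosed_of_isClosed
      hCclosed (isClosed_singleton (x := ‖G x‖))
    exact this
  have hMopen : IsOpen M := by
    rw [isOpen_iff_mem_nhds]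
    rintro y ⟨hyC, hy⟩
    have hloc : IsLocalMax (norm ∘ G) y := by
      filter_upwards [hW.mem_nhds hyC.1] with v hv
      simpa [hy] using hmaxW v hv
    filter_upwards [Complex.eventually_eq_of_isLocalMax_norm
      (hG.eventually_differentiableAt (hW.mem_nhds hyC.1)) hloc, hW.mem_nhds hyC.1] with v hv hvW
    have : ‖G v‖ = ‖G x‖ := by rw [hv, hy]
    exact ⟨⟨hvW, this ▸ hx.2⟩, this⟩
  have hMuniv : M = univ := IsClopen.eq_univ ⟨hMclosed, hMopen⟩ ⟨x, hx, rfl⟩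
  have : IsCompact (univ : Set ℂ) := hMuniv ▸ hCcomp.of_isClosed_subset hMclosed fun y hy => hy.1
  exact noncompact_univ ℂ this

/-- The maximum principle for the imaginary part of a holomorphic function. -/
theorem im_nonpos_of_eventually_boundary_lt {W : Set ℂ} (hW : IsOpen W) {F : ℂ → ℂ}
    (hF : DifferentiableOn ℂ F W)
    (hb : ∀ κ > 0, ∀ z, z ∉ W → ∀ᶠ y in 𝓝[W] z, (F y).im < κ)
    (hinf : ∀ κ > 0, ∀ᶠ y in Bornology.cobounded ℂ ⊓ 𝓟 W, (F y).im < κ) {z : ℂ} (hz : z ∈ W) :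
    (F z).im ≤ 0 := by
  have hnorm : ∀ y, ‖Complex.exp (-Complex.I * F y)‖ = Real.exp (F y).im := fun y => by
    simp [Complex.norm_exp]
  refine le_of_forall_gt_imp_ge_of_dense fun κ hκ => ?_
  have := norm_lt_of_eventually_boundary_lt hW (G := fun y => Complex.exp (-Complex.I * F y))
    (c := Real.exp κ) (hF.const_mul _).cexp
    (fun z hz => by simpa only [hnorm, Real.exp_lt_exp] using hb κ hκ z hz)
    (by simpa only [hnorm, Real.exp_lt_exp] using hinf κ hκ) hz
  rw [hnorm, Real.exp_lt_exp] at this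
  exact this.le

/-- A function with a continuous left inverse leaves every compact set near the boundary. -/
theorem eventually_notMem_compact_of_leftInvOn {U V Q : Set ℂ} {f g : ℂ → ℂ}
    (hf : ContinuousOn f V) (hfm : MapsTo f V U) (hfg : LeftInvOn f g U) (hQ : IsCompact Q)
    (hQV : Q ⊆ V) {z : ℂ} (hz : z ∉ U) : ∀ᶠ y in 𝓝[U] z, g y ∉ Q := by
  have hcomp : IsCompact (f '' Q) := hQ.image_of_continuousOn (hf.mono hQV)
  have hmem : (f '' Q)ᶜ ∈ 𝓝 z := hcomp.isClosed.isOpen_compl.mem_nhds fun ⟨w, hw, hwz⟩ =>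
    hz (hwz ▸ hfm (hQV hw))
  filter_upwards [mem_nhdsWithin_of_mem_nhds hmem, self_mem_nhdsWithin] with y hy hyU hyQ
  exact hy ⟨g y, hyQ, hfg hyU⟩

/-! ### Radial hulls: boundary behaviour and comparison of capacities. -/

namespace LoewnerCase

theorem isOpen_domain (c : LoewnerCase) : IsOpen c.domain := by
  cases c
  · exact isOpen_ball
  · exact isOpen_lt continuous_const Complex.continuous_im

theorem IsHull.isOpen_diff {c : LoewnerCase} {K : Set ℂ} (hK : c.IsHull K) :
    IsOpen (c.domain \ K) :=
  c.isOpen_domain.sdiff hK.isCompact.isClosed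

theorem IsHull.zero_mem_diff {K : Set ℂ} (hK : radial.IsHull K) : (0 : ℂ) ∈ radial.domain \ K :=
  ⟨mem_ball_self one_pos, hK.avoidsTarget⟩

/-- In the radial case, the mapping-out function is close to the unit circle near the hull. -/
theorem radial_near_hull {L : Set ℂ} {g : ℂ → ℂ} {s : ℝ≥0} (hL : radial.IsHull L)
    (hg : radial.IsMappingOut L g) (hs : radial.MappingOutCapacity g L s) {a z : ℂ} (ha : a ∈ L)
    (hz : z ∈ radial.domain \ L) :
    Real.exp (-s) * (1 - ‖g z‖) ^ 24 ≤ 24 ^ 2 * dist z a := by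
  obtain ⟨f, hf, hinv, hfm⟩ := exists_holomorphic_inverse hL.isOpen_diff hg.1.1 hg.1.2
  change DifferentiableOn ℂ f (ball 0 1) at hf
  have hg0 : g 0 = 0 := hg.2.1
  have hf0 : f 0 = 0 := by
    have := hinv.1 hL.zero_mem_diff
    rwa [hg0] at this
  have haU : a ∉ radial.domain \ L := fun h => h.2 ha
  have hsub : ∀ w : ℂ, ball w (1 - ‖w‖) ⊆ ball 0 1 := fun w =>
    ball_subset_ball' (by simp)
  have koebe : ∀ w : ℂ, ‖w‖ < 1 → ‖deriv f w‖ * (1 - ‖w‖) ≤ 24 * ‖f w - a‖ := by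
    intro w hw
    have hr : 0 < 1 - ‖w‖ := sub_pos.2 hw
    have := norm_deriv_le_of_omitted hL.isOpen_diff hL.simplyConnected hr
      (hf.mono (hsub w)) (hfm.mono_left (hsub w)) haU
    rwa [le_div_iff₀ hr, dist_eq_norm] at this
  have hderiv0 : deriv f 0 = (deriv g 0)⁻¹ := by
    have hgd : HasDerivAt g (deriv g 0) (f 0) := by
      rw [hf0]
      exact (hg.1.1.differentiableAt (hL.isOpen_diff.mem_nhds hL.zero_mem_diff)).hasDerivAt
    have hfd : HasDerivAt f (deriv f 0) 0 :=
      (hf.differentiableAt (ball_mem_nhds _ one_pos)).hasDerivAt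
    have h1 := (hgd.comp 0 hfd).unique ((hasDerivAt_id (0 : ℂ)).congr_of_eventuallyEq (by
      filter_upwards [ball_mem_nhds (0 : ℂ) one_pos] with y hy using hinv.2 hy))
    exact eq_inv_of_mul_eq_one_right h1
  -- The Koebe bound at `0` keeps the hull away from the origin.
  have hcap : Real.exp (-s) ≤ 24 * ‖a‖ := by
    have h1 := koebe 0 (by simp)
    rw [hderiv0, hs, hf0] at h1
    simpa [Complex.norm_exp] using h1
  set w := g z with hw
  have hw1 : ‖w‖ < 1 := by simpa [domain] using hg.1.2.1 hz
  have hfw : f w = z := hinv.1 hz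
  obtain ⟨u, hu, hwu⟩ : ∃ u : ℂ, ‖u‖ = 1 ∧ w = ‖w‖ * u := by
    by_cases h0 : w = 0
    · exact ⟨1, by simp, by simp [h0]⟩
    · refine ⟨w / ‖w‖, by simp [h0], ?_⟩
      field_simp [norm_ne_zero_iff.2 h0]
  set S := -Real.log (1 - ‖w‖) with hS
  have hS0 : 0 ≤ S := neg_nonneg.2 (Real.log_nonpos (by linarith) (by linarith [norm_nonneg w]))
  have hexpS : Real.exp (-S) = 1 - ‖w‖ := by rw [hS, neg_neg, Real.exp_log (by linarith)]
  -- The radius to `w`, run with speed `1 - ‖v σ‖`, so that the Koebe bound becomes a linear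
  -- differential inequality for `f (v σ) - a` with constant `24`.
  set v : ℝ → ℂ := fun σ => ((1 - Real.exp (-σ) : ℝ) : ℂ) * u with hv
  have hvnorm : ∀ σ ∈ Icc 0 S, ‖v σ‖ = 1 - Real.exp (-σ) := by
    intro σ hσ
    rw [hv, norm_mul, hu, mul_one, Complex.norm_real, Real.norm_of_nonneg]
    linarith [Real.exp_le_one_iff.2 (neg_nonpos.2 hσ.1)]
  have hv1 : ∀ σ ∈ Icc 0 S, ‖v σ‖ < 1 := fun σ hσ => by
    rw [hvnorm σ hσ]; linarith [Real.exp_pos (-σ)]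
  have hvd : ∀ σ, HasDerivAt v ((Real.exp (-σ) : ℝ) * u) σ := by
    intro σ
    have h1 : HasDerivAt (fun σ : ℝ => 1 - Real.exp (-σ)) (Real.exp (-σ)) σ := by
      simpa using ((Real.hasDerivAt_exp (-σ)).comp σ (hasDerivAt_neg σ)).const_sub 1
    exact h1.ofReal_comp.mul_const u
  have hgron := norm_le_norm_mul_exp_of_norm_deriv_le (p := fun σ => f (v σ) - a)
    (p' := fun σ => ((Real.exp (-σ) : ℝ) * u) * deriv f (v σ)) (C := 24) hS0
    (fun σ hσ => by
      have h1 : HasDerivAt f (deriv f (v σ)) (v σ) :=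
        (hf.differentiableAt (isOpen_ball.mem_nhds (by simpa using hv1 σ hσ))).hasDerivAt
      exact (h1.scomp σ (hvd σ)).sub_const a)
    (fun σ hσ => by
      have h1 := koebe (v σ) (hv1 σ hσ)
      rw [hvnorm σ hσ] at h1
      rw [norm_mul, norm_mul, hu, mul_one, Complex.norm_real,
        Real.norm_of_nonneg (Real.exp_pos _).le]
      linarith)
  have hvS : v S = w := by simp only [hv]; rw [hexpS, sub_sub_cancel]; exact hwu.symm
  have hv0 : v 0 = 0 := by simp [hv]
  simp only [hvS, hv0, hf0, zero_sub, norm_neg, hfw] at hgron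
  have hE : Real.exp (24 * S) * (1 - ‖w‖) ^ 24 = 1 := by
    rw [← hexpS, ← Real.exp_nat_mul, ← Real.exp_add]; simp
  have hp : 0 ≤ (1 - ‖w‖) ^ 24 := pow_nonneg (by linarith) _
  calc Real.exp (-s) * (1 - ‖w‖) ^ 24
      ≤ 24 * ‖a‖ * (1 - ‖w‖) ^ 24 := by gcongr
    _ ≤ 24 * (‖z - a‖ * Real.exp (24 * S)) * (1 - ‖w‖) ^ 24 := by gcongr
    _ = 24 * ‖z - a‖ * (Real.exp (24 * S) * (1 - ‖w‖) ^ 24) := by ring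
    _ ≤ 24 ^ 2 * dist z a := by
      rw [hE, dist_eq_norm]; nlinarith [norm_nonneg (z - a)]

/-- One-sided continuity of the capacity, in the radial case. -/
theorem radial_capacity_le {K L : Set ℂ} {t s : ℝ≥0} (hK : radial.IsHullOfCapacity K t)
    (hL : radial.IsHullOfCapacity L s) {ε η : ℝ} (hε : 0 < ε) (hη0 : 0 < η) (hη1 : η < 1)
    (hsmall : 24 ^ 2 * (2 * ε) ≤ Real.exp (-s) * η ^ 24)
    (hKL : ∀ z ∈ K, ∃ a ∈ L, dist z a < ε) : (t : ℝ) ≤ s - Real.log (1 - η) := by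
  obtain ⟨hK, k, hk, hkt⟩ := hK
  obtain ⟨hL, g, hg, hgs⟩ := hL
  obtain ⟨f, hf, hinv, hfm⟩ := exists_holomorphic_inverse hL.isOpen_diff hg.1.1 hg.1.2
  have hk0 : k 0 = 0 := hk.2.1
  have hg0 : g 0 = 0 := hg.2.1
  set W := (radial.domain \ K) ∩ (radial.domain \ L) with hWdef
  have hW : IsOpen W := hK.isOpen_diff.inter hL.isOpen_diff
  have h0W : (0 : ℂ) ∈ W := ⟨hK.zero_mem_diff, hL.zero_mem_diff⟩
  have hgne : ∀ z ∈ radial.domain \ L, z ≠ 0 → g z ≠ 0 := fun z hz hne h =>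
    hne (hg.1.2.2.1 hz hL.zero_mem_diff (h.trans hg0.symm))
  have hg'0 : deriv g 0 ≠ 0 := by
    obtain ⟨a, ha, h⟩ := hg.2.2
    rw [h]; exact_mod_cast ha.ne'
  have hds : ∀ h : ℂ → ℂ, h 0 = 0 → ∀ z, z ≠ 0 → dslope h 0 z = h z / z := fun h h0 z hz => by
    rw [dslope_of_ne _ hz, slope_def_field, h0, sub_zero, sub_zero]
  have hgs0 : ∀ z ∈ radial.domain \ L, dslope g 0 z ≠ 0 := by
    intro z hz
    by_cases h0 : z = 0
    · rwa [h0, dslope_same]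
    · rw [hds g hg0 z h0]; exact div_ne_zero (hgne z hz h0) h0
  -- This is `k / g` with the singularity at `0` removed; its modulus there is `exp (t - s)`.
  set G : ℂ → ℂ := fun z => dslope k 0 z / dslope g 0 z with hG
  have hGdiff : DifferentiableOn ℂ G W := by
    refine DifferentiableOn.div ?_ ?_ fun z hz => hgs0 z hz.2
    · exact (Complex.differentiableOn_dslope (hW.mem_nhds h0W)).2
        (hk.1.1.mono inter_subset_left)
    · exact (Complex.differentiableOn_dslope (hW.mem_nhds h0W)).2
        (hg.1.1.mono inter_subset_right)
  have hGlt : ∀ m : ℝ, 0 < m → ∀ z ∈ W, z ≠ 0 → m ≤ ‖g z‖ → ‖G z‖ ≤ 1 / m := by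
    intro m hm z hz hz0 hmz
    simp only [hG]
    rw [hds k hk0 z hz0, hds g hg0 z hz0, div_div_div_cancel_right₀ hz0, norm_div]
    have hk1 : ‖k z‖ < 1 := by simpa [domain] using hk.1.2.1 hz.1
    gcongr
  have key : ∀ c : ℝ, 1 / (1 - η) < c → ‖G 0‖ < c := by
    intro c hc
    have h1η : 0 < 1 - η := by linarith
    have hc1 : 1 < c := lt_of_le_of_lt (by rw [le_div_iff₀ h1η]; linarith) hc
    have hc0 : 0 < c := by linarith
    refine norm_lt_of_eventually_boundary_lt hW hGdiff (fun z hz => ?_) ?_ h0W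
    · have hzne : z ≠ 0 := fun h => hz (h ▸ h0W)
      have hne : ∀ᶠ y in 𝓝[W] z, y ≠ 0 :=
        Filter.Eventually.filter_mono nhdsWithin_le_nhds (isOpen_ne.mem_nhds hzne)
      -- Near `K` one is within `2 * ε` of `L`, where `1 - ‖g‖ ≤ η`; at the remaining points outside
      -- `W`, `‖g‖` tends to `1`. Always `‖k‖ < 1`.
      by_cases hzK : z ∈ K
      · filter_upwards [hne, self_mem_nhdsWithin, mem_nhdsWithin_of_mem_nhds (ball_mem_nhds z hε)]
          with y hy0 hyW hy
        obtain ⟨a, ha, hza⟩ := hKL z hzK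
        have hya : dist y a < 2 * ε := by
          linarith [dist_triangle y z a, mem_ball.1 hy]
        have h1 := radial_near_hull hL hg hgs ha hyW.2
        have h2 : Real.exp (-s) * (1 - ‖g y‖) ^ 24 ≤ Real.exp (-s) * η ^ 24 := by linarith
        have h3 := le_of_mul_le_mul_left h2 (Real.exp_pos _)
        have h4 := le_of_pow_le_pow_left₀ (by norm_num) hη0.le h3
        exact (hGlt (1 - η) h1η y hyW hy0 (by linarith)).trans_lt hc
      · have hzL : z ∉ radial.domain \ L := fun h => hz ⟨⟨h.1, hzK⟩, h⟩
        obtain ⟨m, hm1, hm2⟩ := exists_between (show 1 / c < 1 by rwa [div_lt_one hc0])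
        have hm0 : 0 < m := lt_trans (by positivity) hm1
        have hQ := eventually_notMem_compact_of_leftInvOn hf.continuousOn hfm hinv.1
          (isCompact_closedBall (0 : ℂ) m) (closedBall_subset_ball hm2) hzL
        filter_upwards [hne, self_mem_nhdsWithin, nhdsWithin_mono z inter_subset_right hQ]
          with y hy0 hyW hy
        have hy' : m ≤ ‖g y‖ := by
          have : ¬ ‖g y‖ ≤ m := by simpa using hy
          linarith
        refine (hGlt m hm0 y hyW hy0 hy').trans_lt ?_
        rw [div_lt_iff₀ hc0] at hm1
        rw [div_lt_iff₀ hm0]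
        linarith
    · rw [eventually_inf_principal]
      have : (ball (0 : ℂ) 1)ᶜ ∈ Bornology.cobounded ℂ :=
        Bornology.isBounded_def.1 isBounded_ball
      filter_upwards [this] with y hy hyW
      exact absurd hyW.1.1 hy
  have hG0 : ‖G 0‖ = Real.exp t / Real.exp s := by
    have h1 : ∀ {h : ℂ → ℂ} {M : Set ℂ} {r : ℝ≥0}, radial.MappingOutCapacity h M r →
        ‖deriv h 0‖ = Real.exp r := by
      intro h M r hr
      have : deriv h 0 = (((Real.exp (-(r : ℝ)) : ℝ) : ℂ))⁻¹ := by
        rw [← inv_inv (deriv h 0)]; exact congrArg _ hr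
      rw [this, norm_inv, Complex.norm_real, Real.norm_of_nonneg (Real.exp_pos _).le,
        Real.exp_neg, inv_inv]
    simp only [hG, dslope_same, norm_div, h1 hkt, h1 hgs]
  have h1 : ‖G 0‖ ≤ 1 / (1 - η) := le_of_forall_gt_imp_ge_of_dense fun c hc => (key c hc).le
  rw [hG0, ← Real.exp_sub, one_div, ← Real.exp_log (show 0 < 1 - η by linarith), ← Real.exp_neg,
    Real.exp_le_exp] at h1
  linarith

end LoewnerCase

/-! ### Chordal hulls: boundary behaviour and comparison of capacities. -/

/-- A normalized map is uniformly close to the identity near infinity. -/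
theorem LoewnerCase.exists_norm_sub_lt_of_isNormalized {K : Set ℂ} {g : ℂ → ℂ}
    (hg : chordal.IsNormalized g K) {κ : ℝ} (hκ : 0 < κ) :
    ∃ R : ℝ, 0 < R ∧ ∀ z ∈ chordal.domain \ K, R ≤ ‖z‖ → ‖g z - z‖ < κ := by
  have h1 := eventually_inf_principal.1 ((Metric.tendsto_nhds.1 hg) κ hκ)
  obtain ⟨R, -, hR⟩ := (Metric.hasBasis_cobounded_compl_ball (0 : ℂ)).eventually_iff.1 h1
  refine ⟨max R 1, by positivity, fun z hz hRz => ?_⟩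
  simpa using hR (x := z) (by simpa using (le_max_left R 1).trans hRz) hz

/-- The exponential maps a convex half-strip onto this set. -/
theorem isPreconnected_upperHalfPlane_outside_ball {ρ : ℝ} (hρ : 0 < ρ) :
    IsPreconnected {w : ℂ | 0 < w.im ∧ ρ < ‖w‖} := by
  have hconv : Convex ℝ {w : ℂ | Real.log ρ < w.re ∧ 0 < w.im ∧ w.im < Real.pi} :=
    (convex_halfSpace_re_gt _).inter ((convex_halfSpace_im_gt _).inter (convex_halfSpace_im_lt _))
  have himage : Complex.exp '' {w : ℂ | Real.log ρ < w.re ∧ 0 < w.im ∧ w.im < Real.pi} =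
      {w : ℂ | 0 < w.im ∧ ρ < ‖w‖} := by
    ext w
    constructor
    · rintro ⟨v, ⟨h1, h2, h3⟩, rfl⟩
      refine ⟨?_, ?_⟩
      · rw [Complex.exp_im]
        exact mul_pos (Real.exp_pos _) (Real.sin_pos_of_pos_of_lt_pi h2 h3)
      · rw [Complex.norm_exp]
        exact (Real.log_lt_iff_lt_exp hρ).1 h1
    · rintro ⟨h1, h2⟩
      have hw : w ≠ 0 := fun h => by simp [h] at h1
      refine ⟨Complex.log w, ⟨?_, ?_, ?_⟩, Complex.exp_log hw⟩
      · rw [Complex.log_re]; exact Real.log_lt_log hρ h2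
      · rw [Complex.log_im]
        refine lt_of_le_of_ne (Complex.arg_nonneg_iff.2 h1.le) fun h => ?_
        exact h1.ne' (Complex.arg_eq_zero_iff.1 h.symm).2
      · rw [Complex.log_im]
        exact Complex.arg_lt_pi_iff.2 (Or.inr h1.ne')
  rw [← himage]
  exact hconv.isPreconnected.image _ Complex.continuous_exp.continuousOn

namespace LoewnerCase

/-- In the chordal case, the mapping-out function is bounded on bounded sets. -/
theorem exists_norm_le_of_isMappingOut {K : Set ℂ} {g : ℂ → ℂ} (hK : chordal.IsHull K)
    (hg : chordal.IsMappingOut K g) :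
    ∃ R : ℝ, ∀ z ∈ chordal.domain \ K, ‖g z‖ ≤ max ‖z‖ R + 1 := by
  obtain ⟨f, hf, hinv, hfm⟩ := exists_holomorphic_inverse hK.isOpen_diff hg.1.1 hg.1.2
  obtain ⟨R₀, hR₀, h₀⟩ := exists_norm_sub_lt_of_isNormalized hg.2 one_pos
  obtain ⟨R₁, hR₁⟩ := hK.isCompact.isBounded.subset_closedBall 0
  set R := max R₀ R₁ with hR
  have hRpos : 0 < R := hR₀.trans_le (le_max_left _ _)
  have hfar : ∀ z ∈ chordal.domain \ K, R ≤ ‖z‖ → ‖g z - z‖ < 1 := fun z hz h =>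
    h₀ z hz ((le_max_left _ _).trans h)
  set S := {w : ℂ | 0 < w.im ∧ R + 1 < ‖w‖}
  have hS : IsPreconnected S := isPreconnected_upperHalfPlane_outside_ball (by linarith)
  -- On `‖z‖ = R` the map `g` moves points by less than `1`, so `f` sends no point of `S` to that
  -- circle. As `S` is connected and `f` is large somewhere on it, `f` maps `S` outside the circle.
  have hSf : ∀ w ∈ S, ‖f w‖ ≠ R := by
    intro w hw h
    have h1 := hfar (f w) (hfm hw.1) h.ge
    rw [hinv.2 hw.1] at h1
    have := norm_sub_norm_le w (f w)
    linarith [hw.2]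
  have hlarge : ∃ w ∈ S, R < ‖f w‖ := by
    set z : ℂ := ((R + 3 : ℝ) : ℂ) * Complex.I with hz
    have hzn : ‖z‖ = R + 3 := by
      rw [hz, norm_mul, Complex.norm_I, mul_one, Complex.norm_real,
        Real.norm_of_nonneg (by linarith)]
    have hzU : z ∈ chordal.domain \ K := by
      refine ⟨?_, fun h => ?_⟩
      · change 0 < z.im
        simp [hz]; linarith
      · have := hR₁ h
        rw [mem_closedBall_zero_iff, hzn] at this
        linarith [le_max_right R₀ R₁]
    refine ⟨g z, ⟨hg.1.2.1 hzU, ?_⟩, ?_⟩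
    · have h1 := hfar z hzU (by linarith)
      have h2 := norm_sub_norm_le z (g z)
      rw [norm_sub_rev] at h2
      linarith
    · rw [hinv.1 hzU, hzn]; linarith
  obtain ⟨w₀, hw₀, hlt₀⟩ := hlarge
  have hall : ∀ w ∈ S, R < ‖f w‖ := by
    intro w hw
    by_contra! hle
    obtain ⟨y, hy, hyR⟩ := hS.intermediate_value hw hw₀
      (hf.continuousOn.norm.mono fun w hw => hw.1) ⟨hle, hlt₀.le⟩
    exact hSf y hy hyR
  refine ⟨R, fun z hz => ?_⟩
  rcases le_or_gt R ‖z‖ with h | h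
  · have h1 := hfar z hz h
    have h2 := norm_sub_norm_le (g z) z
    linarith [le_max_left ‖z‖ R]
  · by_contra! hlt
    have h1 := hall (g z) ⟨hg.1.2.1 hz, by linarith [le_max_right ‖z‖ R]⟩
    rw [hinv.1 hz] at h1
    exact h.not_gt h1

/-- The imaginary part of the mapping-out function vanishes at the boundary. -/
theorem eventually_im_lt_of_isMappingOut {K : Set ℂ} {g : ℂ → ℂ} (hK : chordal.IsHull K)
    (hg : chordal.IsMappingOut K g) {κ : ℝ} (hκ : 0 < κ) {z : ℂ}
    (hz : z ∉ chordal.domain \ K) : ∀ᶠ y in 𝓝[chordal.domain \ K] z, (g y).im < κ := by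
  obtain ⟨f, hf, hinv, hfm⟩ := exists_holomorphic_inverse hK.isOpen_diff hg.1.1 hg.1.2
  obtain ⟨R, hR⟩ := exists_norm_le_of_isMappingOut hK hg
  set B := max (‖z‖ + 1) R + 1
  -- Near `z` the values of `g` stay in the ball but must leave this compact subset of the
  -- half-plane, so their imaginary part is small.
  have hQ : IsCompact (closedBall (0 : ℂ) B ∩ {w | κ ≤ w.im}) :=
    (isCompact_closedBall _ _).inter_right (isClosed_le continuous_const Complex.continuous_im)
  filter_upwards [eventually_notMem_compact_of_leftInvOn hf.continuousOn hfm hinv.1 hQ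
    (fun w hw => hκ.trans_le hw.2) hz, self_mem_nhdsWithin,
    mem_nhdsWithin_of_mem_nhds (ball_mem_nhds z one_pos)] with y hy hyU hyz
  by_contra! hle
  refine hy ⟨?_, hle⟩
  rw [mem_closedBall_zero_iff]
  refine (hR y hyU).trans ?_
  have h1 : ‖y‖ ≤ ‖z‖ + 1 := by
    have := norm_sub_norm_le y z
    rw [mem_ball, dist_eq_norm] at hyz
    linarith
  exact add_le_add_left (max_le_max_right R h1) 1

/-- In the chordal case, the mapping-out function decreases imaginary parts. -/
theorem im_le_im_of_isMappingOut {K : Set ℂ} {g : ℂ → ℂ} (hK : chordal.IsHull K)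
    (hg : chordal.IsMappingOut K g) {z : ℂ} (hz : z ∈ chordal.domain \ K) :
    (g z).im ≤ z.im := by
  have := im_nonpos_of_eventually_boundary_lt hK.isOpen_diff (F := fun z => g z - z)
    (hg.1.1.sub differentiableOn_id)
    (fun κ hκ z hz => by
      filter_upwards [eventually_im_lt_of_isMappingOut hK hg hκ hz, self_mem_nhdsWithin]
        with y hy hyU
      have : 0 < y.im := hyU.1
      rw [Complex.sub_im]; linarith)
    (fun κ hκ => by
      filter_upwards [(Metric.tendsto_nhds.1 hg.2) κ hκ] with y hy
      rw [dist_zero_right] at hy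
      exact ((le_abs_self _).trans (Complex.abs_im_le_norm _)).trans_lt hy) hz
  rw [Complex.sub_im] at this
  linarith

/-- In the chordal case, the mapping-out function has small imaginary part near the hull. -/
theorem chordal_near_hull {L : Set ℂ} {g : ℂ → ℂ} {R : ℝ} (hL : chordal.IsHull L)
    (hg : chordal.IsMappingOut L g) (hR : L ⊆ closedBall 0 R) {a z : ℂ} (ha : a ∈ L)
    (hz : z ∈ chordal.domain \ L) (hza : dist z a ≤ 1) :
    (g z).im ^ 24 ≤ dist z a * (R + 1) ^ 24 := by
  obtain ⟨f, hf, hinv, hfm⟩ := exists_holomorphic_inverse hL.isOpen_diff hg.1.1 hg.1.2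
  have haU : a ∉ chordal.domain \ L := fun h => h.2 ha
  set w := g z with hw
  have hw0 : 0 < w.im := hg.1.2.1 hz
  have hfw : f w = z := hinv.1 hz
  have haR : ‖a‖ ≤ R := by simpa using hR ha
  have hsub : ∀ v : ℂ, ball v v.im ⊆ chordal.domain := by
    intro v y hy
    change 0 < y.im
    have h1 := (abs_le.1 (Complex.abs_im_le_norm (y - v))).1
    rw [mem_ball, dist_eq_norm] at hy
    rw [Complex.sub_im] at h1
    linarith
  have koebe : ∀ v : ℂ, 0 < v.im → ‖deriv f v‖ * v.im ≤ 24 * ‖f v - a‖ := by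
    intro v hv
    have := norm_deriv_le_of_omitted hL.isOpen_diff hL.simplyConnected hv
      (hf.mono (hsub v)) (hfm.mono_left (hsub v)) haU
    rwa [le_div_iff₀ hv, dist_eq_norm] at this
  set Y := R + 1 with hY
  have hzim : z.im ≤ Y := by
    have h1 : z.im ≤ ‖z‖ := (le_abs_self _).trans (Complex.abs_im_le_norm z)
    have h2 := norm_sub_norm_le z a
    rw [dist_eq_norm] at hza
    linarith
  have hwY : w.im ≤ Y := (im_le_im_of_isMappingOut hL hg hz).trans hzim
  have hYpos : 0 < Y := hw0.trans_le hwY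
  set S := Real.log (Y / w.im) with hS
  have hS0 : 0 ≤ S := Real.log_nonneg ((one_le_div hw0).2 hwY)
  have hexpS : Real.exp (-S) * Y = w.im := by
    rw [hS, Real.exp_neg, Real.exp_log (div_pos hYpos hw0)]
    field_simp
  -- The vertical segment from height `Y` down to `w`, with speed equal to the height.
  set v : ℝ → ℂ := fun σ => w.re + ((Real.exp (-σ) * Y : ℝ) : ℂ) * Complex.I with hv
  have hvim : ∀ σ, (v σ).im = Real.exp (-σ) * Y := fun σ => by
    simp only [hv, Complex.add_im, Complex.ofReal_im, Complex.im_ofReal_mul, Complex.I_im, mul_one,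
      zero_add]
  have hvpos : ∀ σ, 0 < (v σ).im := fun σ => by rw [hvim]; positivity
  have hvd : ∀ σ, HasDerivAt v ((-(Real.exp (-σ) * Y) : ℝ) * Complex.I) σ := by
    intro σ
    have h1 : HasDerivAt (fun σ : ℝ => Real.exp (-σ) * Y) (-(Real.exp (-σ) * Y)) σ := by
      simpa using ((Real.hasDerivAt_exp (-σ)).comp σ (hasDerivAt_neg σ)).mul_const Y
    exact (h1.ofReal_comp.mul_const Complex.I).const_add _
  have hgron := norm_le_norm_mul_exp_of_norm_deriv_le (p := fun σ => f (v σ) - a)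
    (p' := fun σ => ((-(Real.exp (-σ) * Y) : ℝ) * Complex.I) * deriv f (v σ)) (C := 24) hS0
    (fun σ _ => by
      have h1 : HasDerivAt f (deriv f (v σ)) (v σ) :=
        (hf.differentiableAt (chordal.isOpen_domain.mem_nhds (hvpos σ))).hasDerivAt
      exact (h1.scomp σ (hvd σ)).sub_const a)
    (fun σ _ => by
      have h1 := koebe (v σ) (hvpos σ)
      rw [norm_mul, norm_mul, Complex.norm_I, mul_one, Complex.norm_real, norm_neg,
        Real.norm_of_nonneg (by positivity), ← hvim]
      linarith)
  have hvS : v S = w := by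
    apply Complex.ext
    · simp only [hv, Complex.add_re, Complex.ofReal_re, Complex.re_ofReal_mul, Complex.I_re,
        mul_zero, add_zero]
    · rw [hvim, hexpS]
  -- `f` does not decrease imaginary parts, so `f (v 0)` has height at least `Y = R + 1`, while `a`
  -- has height at most `R`.
  have hfar : 1 ≤ ‖f (v 0) - a‖ := by
    have h1 := im_le_im_of_isMappingOut hL hg (hfm (hvpos 0))
    rw [hinv.2 (hvpos 0), hvim, neg_zero, Real.exp_zero, one_mul] at h1
    have h2 := (le_abs_self _).trans (Complex.abs_im_le_norm (f (v 0) - a))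
    have h3 := (le_abs_self _).trans (Complex.abs_im_le_norm a)
    rw [Complex.sub_im] at h2
    linarith
  simp only [hvS, hfw] at hgron
  have hE : Real.exp (24 * S) * w.im ^ 24 = Y ^ 24 := by
    rw [← hexpS, mul_pow, ← Real.exp_nat_mul, ← mul_assoc, ← Real.exp_add]; simp
  calc w.im ^ 24 = 1 * w.im ^ 24 := (one_mul _).symm
    _ ≤ (‖z - a‖ * Real.exp (24 * S)) * w.im ^ 24 := by
        gcongr; exact hfar.trans hgron
    _ = dist z a * Y ^ 24 := by rw [mul_assoc, hE, dist_eq_norm]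

/-- One-sided continuity of the capacity, in the chordal case. -/
theorem chordal_capacity_le {K L : Set ℂ} {t s : ℝ≥0} (hK : chordal.IsHullOfCapacity K t)
    (hL : chordal.IsHullOfCapacity L s) {ε η R : ℝ} (hε : 0 < ε) (hη : 0 < η)
    (hKR : K ⊆ ball 0 R) (hLR : L ⊆ closedBall 0 R) (hε1 : 2 * ε ≤ 1)
    (hsmall : 2 * ε * (R + 1) ^ 24 ≤ η ^ 24)
    (hKL : ∀ z ∈ K, ∃ a ∈ L, dist z a < ε) : (t : ℝ) ≤ s + η * R := by
  obtain ⟨hK, k, hk, hkt⟩ := hK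
  obtain ⟨hL, g, hg, hgs⟩ := hL
  have hR : 0 < R := by simpa using pos_of_mem_ball (hKR hK.start_mem)
  set W := (chordal.domain \ K) ∩ (chordal.domain \ L) with hWdef
  have hW : IsOpen W := hK.isOpen_diff.inter hL.isOpen_diff
  have him : ∀ z ∈ W, 0 < z.im := fun z hz => hz.1.1
  -- Near `K` one only knows `Im g ≤ η`. The correction `β` absorbs this: its imaginary part is
  -- negative on the half-plane and at most `-η` on the half-disk of radius `R`. Its decay like `2 R
  -- η / z` costs `η * R` in capacity.
  set β : ℂ → ℂ := fun z => ((2 * R * η : ℝ) : ℂ) / (z + R * Complex.I) with hβ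
  have hβne : ∀ z : ℂ, 0 < z.im → z + R * Complex.I ≠ 0 := fun z hz h => by
    have := congrArg Complex.im h
    simp at this
    linarith
  have hβim : ∀ z : ℂ, (β z).im = -(2 * R * η * (z.im + R) / ‖z + R * Complex.I‖ ^ 2) := by
    intro z
    simp only [hβ, Complex.div_im, Complex.ofReal_im, Complex.ofReal_re, ← Complex.normSq_eq_norm_sq]
    simp
  have hβle : ∀ z : ℂ, 0 < z.im → (β z).im ≤ 0 := fun z hz => by
    rw [hβim, neg_nonpos]; positivity
  have hβle' : ∀ z : ℂ, 0 < z.im → ‖z‖ ≤ R → (β z).im ≤ -η := by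
    intro z hz hzR
    have hpos : 0 < ‖z + R * Complex.I‖ ^ 2 := by
      have := norm_pos_iff.2 (hβne z hz); positivity
    rw [hβim, neg_le_neg_iff, le_div_iff₀ hpos]
    have h1 : ‖z + R * Complex.I‖ ^ 2 = ‖z‖ ^ 2 + 2 * R * z.im + R ^ 2 := by
      rw [← Complex.normSq_eq_norm_sq, ← Complex.normSq_eq_norm_sq, Complex.normSq_apply,
        Complex.normSq_apply]
      simp; ring
    have h2 : ‖z‖ ^ 2 ≤ R ^ 2 := by gcongr
    rw [h1]
    nlinarith
  have hmain : ∀ z ∈ W, (g z - k z + β z).im ≤ 0 := by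
    intro z hz
    refine im_nonpos_of_eventually_boundary_lt hW (F := fun z => g z - k z + β z) ?_ ?_ ?_ hz
    · refine ((hg.1.1.mono inter_subset_right).sub (hk.1.1.mono inter_subset_left)).add ?_
      exact (differentiableOn_const _).div (by fun_prop) fun z hz => hβne z (him z hz)
    · intro κ hκ z hz
      by_cases hzK : z ∈ K
      · filter_upwards [self_mem_nhdsWithin, mem_nhdsWithin_of_mem_nhds (ball_mem_nhds z hε),
          mem_nhdsWithin_of_mem_nhds (isOpen_ball.mem_nhds (hKR hzK))] with y hyW hy hyR
        obtain ⟨a, ha, hza⟩ := hKL z hzK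
        have hya : dist y a < 2 * ε := by
          linarith [dist_triangle y z a, mem_ball.1 hy]
        have h1 := chordal_near_hull hL hg hLR ha hyW.2 (by linarith)
        have h2 : (g y).im ^ 24 ≤ η ^ 24 := h1.trans (le_trans (by gcongr) hsmall)
        have h3 := le_of_pow_le_pow_left₀ (by norm_num) hη.le h2
        have h4 := hβle' y (him y hyW) (by simpa using (mem_ball.1 hyR).le)
        have h5 : 0 < (k y).im := hk.1.2.1 hyW.1
        rw [Complex.add_im, Complex.sub_im]
        linarith
      · have hzL : z ∉ chordal.domain \ L := fun h => hz ⟨⟨h.1, hzK⟩, h⟩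
        filter_upwards [self_mem_nhdsWithin, nhdsWithin_mono z inter_subset_right
          (eventually_im_lt_of_isMappingOut hL hg hκ hzL)] with y hyW hy
        have h4 := hβle y (him y hyW)
        have h5 : 0 < (k y).im := hk.1.2.1 hyW.1
        rw [Complex.add_im, Complex.sub_im]
        linarith
    · intro κ hκ
      have h1 := eventually_inf_principal.1 ((Metric.tendsto_nhds.1 hg.2) (κ / 2) (half_pos hκ))
      have h2 := eventually_inf_principal.1 ((Metric.tendsto_nhds.1 hk.2) (κ / 2) (half_pos hκ))
      rw [eventually_inf_principal]
      filter_upwards [h1, h2] with y hy1 hy2 hyW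
      have h3 := hy1 hyW.2
      have h4 := hy2 hyW.1
      rw [dist_zero_right] at h3 h4
      have h5 := (le_abs_self _).trans (Complex.abs_im_le_norm (g y - y))
      have h6 := (neg_le_abs _).trans (Complex.abs_im_le_norm (k y - y))
      have h7 := hβle y (him y hyW)
      rw [Complex.sub_im] at h5 h6
      rw [Complex.add_im, Complex.sub_im]
      linarith
  have hray : ∀ y : ℝ, ‖(y : ℂ) * Complex.I‖ = |y| := fun y => by simp
  have hlim : ∀ {M : Set ℂ}, M ⊆ closedBall 0 R → Tendsto (fun y : ℝ => (y : ℂ) * Complex.I) atTop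
      (Bornology.cobounded ℂ ⊓ 𝓟 (chordal.domain \ M)) := by
    intro M hM
    rw [tendsto_inf, tendsto_principal, ← tendsto_norm_atTop_iff_cobounded]
    refine ⟨by simpa only [hray] using tendsto_abs_atTop_atTop, ?_⟩
    filter_upwards [eventually_gt_atTop R] with y hy
    refine ⟨?_, fun h => ?_⟩
    · change 0 < ((y : ℂ) * Complex.I).im
      simp; linarith
    · have := hM h
      rw [mem_closedBall_zero_iff, hray] at this
      linarith [le_abs_self y]
  have hlk := hkt.comp (hlim (hKR.trans ball_subset_closedBall))
  have hlg := hgs.comp (hlim hLR)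
  have hre := (Complex.continuous_re.tendsto _).comp (hlk.sub hlg)
  -- At `z = i y` the real part of `z (k z - z) - z (g z - z)` is `y * Im (g z - k z)`, which
  -- `hmain` bounds by `2 R η y / (y + R)`.
  have hle : ∀ᶠ y : ℝ in atTop, (Complex.re ∘ fun y : ℝ =>
      ((fun z => z * (k z - z)) ∘ fun y : ℝ => (y : ℂ) * Complex.I) y -
      ((fun z => z * (g z - z)) ∘ fun y : ℝ => (y : ℂ) * Complex.I) y) y ≤ 2 * R * η := by
    filter_upwards [eventually_gt_atTop 0,
      (tendsto_principal.1 (tendsto_inf.1 (hlim (hKR.trans ball_subset_closedBall))).2),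
      (tendsto_principal.1 (tendsto_inf.1 (hlim hLR)).2)] with y hy hyK hyL
    have h1 := hmain _ ⟨hyK, hyL⟩
    rw [Complex.add_im, Complex.sub_im, hβim] at h1
    have h2 : (y : ℂ) * Complex.I + R * Complex.I = ((y + R : ℝ) : ℂ) * Complex.I := by
      push_cast; ring
    rw [h2, hray, sq_abs] at h1
    have h3 : ((y : ℂ) * Complex.I).im = y := by simp
    rw [h3] at h1
    have h4 : 2 * R * η * (y + R) / (y + R) ^ 2 = 2 * R * η / (y + R) := by
      field_simp
    have h5 : y * (2 * R * η / (y + R)) ≤ 2 * R * η := by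
      rw [mul_div_assoc', div_le_iff₀ (by positivity)]
      have : 0 ≤ 2 * R * η * R := by positivity
      nlinarith
    rw [h4] at h1
    simp only [Function.comp_apply, Complex.sub_re, Complex.mul_re, Complex.sub_im]
    simp
    nlinarith
  have := le_of_tendsto hre hle
  have h2 : ((2 : ℂ) * ((t : ℝ) : ℂ) - 2 * ((s : ℝ) : ℂ)).re = 2 * t - 2 * s := by simp
  rw [h2] at this
  linarith

end LoewnerCase

/-! ### Uniform continuity of capacity, and estimates for the uniformizing map. -/

namespace LoewnerCase

/-- One-sided continuity of the capacity, uniformly on bounded sets of hulls. -/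
theorem exists_capacity_le (c : LoewnerCase) {M δ : ℝ} (hM : 0 < M) (hδ : 0 < δ) :
    ∃ ε > 0, ∀ (K L : Set ℂ) (t s : ℝ≥0), c.IsHullOfCapacity K t → c.IsHullOfCapacity L s →
      (s : ℝ) ≤ M → L ⊆ closedBall 0 M → (∀ z ∈ K, ∃ a ∈ L, dist z a < ε) → (t : ℝ) ≤ s + δ := by
  cases c
  -- Chosen so that `-log (1 - η) = δ`.
  · set η := 1 - Real.exp (-δ) with hη
    have hη0 : 0 < η := sub_pos.2 (Real.exp_lt_one_iff.2 (neg_lt_zero.2 hδ))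
    have hη1 : η < 1 := sub_lt_self _ (Real.exp_pos _)
    set ε := Real.exp (-M) * η ^ 24 / (2 * 24 ^ 2) with hε
    have hε0 : 0 < ε := by positivity
    refine ⟨ε, hε0, fun K L t s hK hL hs _ hKL => ?_⟩
    have := radial_capacity_le hK hL hε0 hη0 hη1 ?_ hKL
    · rwa [hη, sub_sub_cancel, Real.log_exp, sub_neg_eq_add] at this
    · calc (24 : ℝ) ^ 2 * (2 * ε) = Real.exp (-M) * η ^ 24 := by rw [hε]; ring
        _ ≤ _ := by gcongr
  -- `K` lies within `1/2` of `L`, hence in `ball 0 R`; the error `η * R` is then `δ`.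
  · set R := M + 2 with hR
    set η := δ / R with hη
    have hR0 : 0 < R := by linarith
    have hη0 : 0 < η := by positivity
    set ε := min (1 / 2) (η ^ 24 / (2 * (R + 1) ^ 24)) with hε
    have hε0 : 0 < ε := by positivity
    have hεhalf : ε ≤ 1 / 2 := min_le_left _ _
    refine ⟨ε, hε0, fun K L t s hK hL _ hLM hKL => ?_⟩
    have := chordal_capacity_le (R := R) hK hL hε0 hη0 ?_ ?_ ?_ ?_ hKL
    · rwa [hη, div_mul_cancel₀ _ hR0.ne'] at this
    · intro z hz
      obtain ⟨a, ha, hza⟩ := hKL z hz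
      have h1 := mem_closedBall.1 (hLM ha)
      rw [mem_ball]
      linarith [dist_triangle z a 0]
    · exact hLM.trans (closedBall_subset_closedBall (by linarith))
    · linarith
    · have h1 : ε ≤ η ^ 24 / (2 * (R + 1) ^ 24) := min_le_right _ _
      rw [le_div_iff₀ (by positivity)] at h1
      linarith

/-- Hulls which are close in the Hausdorff distance have close capacities. -/
theorem exists_abs_capacity_sub_le (c : LoewnerCase) {M δ : ℝ} (hM : 0 < M) (hδ : 0 < δ) :
    ∃ ε > 0, ∀ (K L : Set ℂ) (t s : ℝ≥0), c.IsHullOfCapacity K t → c.IsHullOfCapacity L s →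
      (s : ℝ) ≤ M → L ⊆ closedBall 0 M → (∀ z ∈ K, ∃ a ∈ L, dist z a < ε) →
      (∀ a ∈ L, ∃ z ∈ K, dist z a < ε) → |(t : ℝ) - s| ≤ δ := by
  obtain ⟨ε₁, hε₁, h₁⟩ := c.exists_capacity_le hM hδ
  -- For the exchanged roles: `t ≤ s + δ`, and `K` is within `1` of `L`.
  obtain ⟨ε₂, hε₂, h₂⟩ := c.exists_capacity_le (M := M + δ + 1) (by linarith) hδ
  refine ⟨min 1 (min ε₁ ε₂), by positivity, fun K L t s hK hL hs hLM hKL hLK => ?_⟩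
  have hts : (t : ℝ) ≤ s + δ := h₁ K L t s hK hL hs hLM fun z hz => by
    obtain ⟨a, ha, h⟩ := hKL z hz
    exact ⟨a, ha, h.trans_le ((min_le_right _ _).trans (min_le_left _ _))⟩
  have hst : (s : ℝ) ≤ t + δ := by
    refine h₂ L K s t hL hK (by linarith) (fun z hz => ?_) fun a ha => ?_
    · obtain ⟨a, ha, h⟩ := hKL z hz
      have h1 := mem_closedBall.1 (hLM ha)
      have h2 := h.trans_le (min_le_left _ _)
      rw [mem_closedBall]
      linarith [dist_triangle z a 0]
    · obtain ⟨z, hz, h⟩ := hLK a ha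
      rw [dist_comm] at h
      exact ⟨z, hz, h.trans_le ((min_le_right _ _).trans (min_le_right _ _))⟩
  rw [abs_le]
  constructor <;> linarith

theorem im_nonneg_of_mem_closure {z : ℂ} (hz : z ∈ closure chordal.domain) : 0 ≤ z.im :=
  closure_minimal (fun _ hw => le_of_lt hw)
    (isClosed_le continuous_const Complex.continuous_im) hz

theorem two_le_norm_add {z : ℂ} (hz : z ∈ closure chordal.domain) : 2 ≤ ‖2 * Complex.I + z‖ := by
  have h1 := (le_abs_self _).trans (Complex.abs_im_le_norm (2 * Complex.I + z))
  simp only [Complex.add_im, Complex.mul_im, Complex.re_ofNat, Complex.I_im, mul_one,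
    Complex.im_ofNat, Complex.I_re, mul_zero, add_zero] at h1
  linarith [im_nonneg_of_mem_closure hz]

/-- Both factors on the left are at least `2`, which yields the Lipschitz bound; the identity also
controls the inverse map. -/
theorem dist_unif_chordal {z w : ℂ} (hz : z ∈ closure chordal.domain)
    (hw : w ∈ closure chordal.domain) :
    dist (chordal.unif z) (chordal.unif w) * (‖2 * Complex.I + z‖ * ‖2 * Complex.I + w‖) =
      4 * dist z w := by
  have hz2 := two_le_norm_add hz
  have hw2 := two_le_norm_add hw
  have hz0 : 2 * Complex.I + z ≠ 0 := norm_pos_iff.1 (by linarith)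
  have hw0 : 2 * Complex.I + w ≠ 0 := norm_pos_iff.1 (by linarith)
  rw [dist_eq_norm, dist_comm z w, dist_eq_norm, ← norm_mul, ← norm_mul]
  have h : (chordal.unif z - chordal.unif w) * ((2 * Complex.I + z) * (2 * Complex.I + w)) =
      4 * Complex.I * (w - z) := by
    simp only [unif]
    field_simp
    ring
  rw [h]
  simp

theorem dist_unif_le (c : LoewnerCase) {z w : ℂ} (hz : z ∈ closure c.domain)
    (hw : w ∈ closure c.domain) : dist (c.unif z) (c.unif w) ≤ dist z w := by
  cases c
  · exact le_rfl
  · have h := dist_unif_chordal hz hw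
    have hz2 := two_le_norm_add hz
    have hw2 := two_le_norm_add hw
    have : 4 ≤ ‖2 * Complex.I + z‖ * ‖2 * Complex.I + w‖ := by nlinarith
    nlinarith [dist_nonneg (x := chordal.unif z) (y := chordal.unif w)]

/-- The inverse of the uniformizing map is uniformly continuous at bounded sets. -/
theorem exists_dist_lt_of_dist_unif_lt (c : LoewnerCase) {M ε : ℝ} (hM : 0 < M) (hε : 0 < ε) :
    ∃ δ > 0, ∀ z ∈ closure c.domain, ∀ w ∈ closure c.domain, ‖z‖ ≤ M →
      dist (c.unif z) (c.unif w) < δ → dist z w < ε := by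
  cases c
  · exact ⟨ε, hε, fun z _ w _ _ h => h⟩
  -- Only `z` is bounded, so `‖2i + w‖` is estimated by `A + dist z w`. The first bound gives `d * A
  -- ≤ 2`, so the term `d * A * dist z w` is absorbed; the second bounds what remains.
  · refine ⟨min (2 / (M + 2)) (2 * ε / (M + 2) ^ 2), by positivity,
      fun z hz w hw hzM hlt => ?_⟩
    have h := dist_unif_chordal hz hw
    set d := dist (chordal.unif z) (chordal.unif w)
    set A := ‖2 * Complex.I + z‖
    have hd0 : 0 ≤ d := dist_nonneg
    have hA2 : 2 ≤ A := two_le_norm_add hz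
    have hA : A ≤ M + 2 := by
      have : A ≤ ‖2 * Complex.I‖ + ‖z‖ := norm_add_le _ _
      simp at this
      linarith
    have hB : ‖2 * Complex.I + w‖ ≤ A + dist z w := by
      have := norm_add_le (2 * Complex.I + z) (w - z)
      rwa [dist_comm, dist_eq_norm, ← show 2 * Complex.I + z + (w - z) = 2 * Complex.I + w by ring]
    have h1 := hlt.trans_le (min_le_left _ _)
    have h2 := hlt.trans_le (min_le_right _ _)
    rw [lt_div_iff₀ (by positivity)] at h1 h2
    have h3 : d * A ≤ 2 := by nlinarith
    have h4 : d * A ^ 2 < 2 * ε := lt_of_le_of_lt (by gcongr) h2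
    have h5 : 4 * dist z w ≤ d * A * (A + dist z w) := by
      rw [← h, ← mul_assoc]; gcongr
    nlinarith [dist_nonneg (x := z) (y := w)]

end LoewnerCase

/-! ### Curves: approximation, time comparison, reparameterization. -/

namespace LoewnerCurve

variable {c : LoewnerCase}

theorem path_min (γ : LoewnerCurve c) (t : ℝ≥0) : γ.path (min t γ.duration) = γ.path t := by
  rcases le_total t γ.duration with h | h
  · rw [min_eq_left h]
  · rw [min_eq_right h, γ.stopped t h]

theorem exists_norm_path_le (γ : LoewnerCurve c) : ∃ M > 0, ∀ t, ‖γ.path t‖ ≤ M := by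
  obtain ⟨M, hM⟩ := ((isCompact_Icc (a := (0 : ℝ≥0)) (b := γ.duration)).image
    γ.continuous_path).isBounded.subset_closedBall 0
  refine ⟨max M 1, by positivity, fun t => ?_⟩
  rw [← γ.path_min t]
  have := hM (mem_image_of_mem γ.path (show min t γ.duration ∈ Icc 0 γ.duration from
    ⟨zero_le, min_le_right _ _⟩))
  exact (mem_closedBall_zero_iff.1 this).trans (le_max_left _ _)

theorem exists_dist_path_lt (γ : LoewnerCurve c) {ε : ℝ} (hε : 0 < ε) :
    ∃ δ > 0, ∀ a b, dist a b < δ → dist (γ.path a) (γ.path b) < ε := by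
  obtain ⟨δ, hδ, h⟩ := Metric.uniformContinuousOn_iff.1
    ((isCompact_Icc (a := (0 : ℝ≥0)) (b := γ.duration)).uniformContinuousOn_of_continuous
      γ.continuous_path.continuousOn) ε hε
  refine ⟨δ, hδ, fun a b hab => ?_⟩
  rw [← γ.path_min a, ← γ.path_min b]
  refine h _ ⟨zero_le, min_le_right _ _⟩ _ ⟨zero_le, min_le_right _ _⟩ (lt_of_le_of_lt ?_ hab)
  rw [NNReal.dist_eq, NNReal.dist_eq, NNReal.coe_min, NNReal.coe_min]
  simpa using abs_min_sub_min_le_max (a : ℝ) γ.duration b γ.duration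

theorem distCap_le_distEucl (γ η : LoewnerCurve c) : distCap γ η ≤ distEucl γ η := by
  refine iSup_mono fun t => ?_
  rw [edist_dist, edist_dist]
  exact ENNReal.ofReal_le_ofReal (c.dist_unif_le (γ.path_mem t) (η.path_mem t))

theorem dist_lt_of_distCap_lt {γ η : LoewnerCurve c} {ε : ℝ}
    (h : distCap γ η < ENNReal.ofReal ε) (t : ℝ≥0) :
    dist (c.unif (γ.path t)) (c.unif (η.path t)) < ε :=
  edist_lt_ofReal.1 ((le_iSup (fun t => edist (c.unif (γ.path t)) (c.unif (η.path t))) t).trans_lt h)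

theorem exists_dist_path_lt_of_distCap_lt (γ : LoewnerCurve c) {ε : ℝ} (hε : 0 < ε) :
    ∃ δ > 0, ∀ η : LoewnerCurve c, distCap γ η < ENNReal.ofReal δ →
      ∀ t, dist (γ.path t) (η.path t) < ε := by
  obtain ⟨M, hM, hγ⟩ := γ.exists_norm_path_le
  obtain ⟨δ, hδ, h⟩ := c.exists_dist_lt_of_dist_unif_lt hM hε
  exact ⟨δ, hδ, fun η hη t => h _ (γ.path_mem t) _ (η.path_mem t) (hγ t)
    (dist_lt_of_distCap_lt hη t)⟩

/-- Initial segments of a limit curve are not known to be hulls; those of the approximant are, at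
the same times and with the right capacities. -/
theorem MemClosure.exists_simple {γ : LoewnerCurve c} {T : ℝ≥0} (hγ : γ.MemClosure T) {ε : ℝ}
    (hε : 0 < ε) : ∃ η : LoewnerCurve c, η.IsSimpleCapacityCurve ∧ η.duration = γ.duration ∧
      ∀ t, dist (γ.path t) (η.path t) < ε := by
  obtain ⟨δ, hδ, h⟩ := γ.exists_dist_path_lt_of_distCap_lt hε
  obtain ⟨η, hη, hT, hd⟩ := hγ.2 _ (ENNReal.ofReal_pos.2 hδ)
  exact ⟨η, hη, hT.trans hγ.1.symm, h η hd⟩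

/-- Initial segments of limit curves which are close in the Hausdorff distance have close
capacities. -/
theorem exists_abs_time_sub_le (c : LoewnerCase) {M δ : ℝ} (hM : 0 < M) (hδ : 0 < δ) :
    ∃ ε > 0, ∀ (γ η : LoewnerCurve c) (T S : ℝ≥0), γ.MemClosure T → η.MemClosure S →
      ∀ t ≤ γ.duration, ∀ s ≤ η.duration, (t : ℝ) ≤ M → (∀ r, ‖γ.path r‖ ≤ M) →
      (∀ a ≤ t, ∃ b ≤ s, dist (γ.path a) (η.path b) < ε) →
      (∀ b ≤ s, ∃ a ≤ t, dist (γ.path a) (η.path b) < ε) → |(s : ℝ) - t| ≤ δ := by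
  -- Applied to simple approximants of both curves; `M + 1` because the one of `γ` is within `1`.
  obtain ⟨ε, hε, h⟩ := c.exists_abs_capacity_sub_le (M := M + 1) (by linarith) hδ
  refine ⟨ε / 3, by positivity, fun γ η T S hγ hη t ht s hs htM hγM h₁ h₂ => ?_⟩
  obtain ⟨γ', hγ', hγT, hγd⟩ := hγ.exists_simple (ε := min 1 (ε / 3)) (by positivity)
  obtain ⟨η', hη', hηT, hηd⟩ := hη.exists_simple (ε := ε / 3) (by positivity)
  have hclose : ∀ a b, dist (γ.path a) (η.path b) < ε / 3 →
      dist (η'.path b) (γ'.path a) < ε := by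
    intro a b hab
    have h3 := (hγd a).trans_le (min_le_right _ _)
    have h4 := hηd b
    rw [dist_comm] at h4 hab
    linarith [dist_triangle4 (η'.path b) (η.path b) (γ.path a) (γ'.path a)]
  refine h (η'.path '' Icc 0 s) (γ'.path '' Icc 0 t) s t
    (hη'.hull s ⟨zero_le, hs.trans hηT.ge⟩) (hγ'.hull t ⟨zero_le, ht.trans hγT.ge⟩)
    (by linarith) ?_ ?_ ?_
  · rintro _ ⟨a, -, rfl⟩
    have h3 := (hγd a).trans_le (min_le_left _ _)
    rw [dist_comm] at h3
    have h4 := hγM a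
    rw [← dist_zero_right] at h4
    rw [mem_closedBall]
    linarith [dist_triangle (γ'.path a) (γ.path a) 0]
  · rintro _ ⟨b, hb, rfl⟩
    obtain ⟨a, ha, hab⟩ := h₂ b hb.2
    exact ⟨_, mem_image_of_mem _ ⟨zero_le, ha⟩, hclose a b hab⟩
  · rintro _ ⟨a, ha, rfl⟩
    obtain ⟨b, hb, hab⟩ := h₁ a ha.2
    exact ⟨_, mem_image_of_mem _ ⟨zero_le, hb⟩, hclose a b hab⟩

/-- Equal stopped paths do not formally have equal durations; these agree because the traces have
the same capacity, in the approximate sense of `exists_abs_time_sub_le`. -/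
theorem eq_of_distCap_eq_zero {γ η : LoewnerCurve c} {T S : ℝ≥0} (hγ : γ.MemClosure T)
    (hη : η.MemClosure S) (h : distCap γ η = 0) : γ = η := by
  have hpath : ∀ t, γ.path t = η.path t := fun t => by
    refine eq_of_forall_dist_le fun ε hε => ?_
    obtain ⟨δ, hδ, hd⟩ := γ.exists_dist_path_lt_of_distCap_lt hε
    exact (hd η (by rw [h]; exact ENNReal.ofReal_pos.2 hδ) t).le
  have hdur : (η.duration : ℝ) = γ.duration := by
    refine eq_of_forall_dist_le fun δ hδ => ?_
    obtain ⟨M, hM, hγM⟩ := γ.exists_norm_path_le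
    obtain ⟨ε, hε, hε'⟩ := exists_abs_time_sub_le c (M := max M (γ.duration : ℝ))
      (lt_max_of_lt_left hM) hδ
    refine hε' γ η T S hγ hη _ le_rfl _ le_rfl (le_max_right _ _)
      (fun r => (hγM r).trans (le_max_left _ _)) (fun a _ => ?_) (fun b _ => ?_)
    · exact ⟨min a η.duration, min_le_right _ _, by rw [η.path_min, hpath, dist_self]; exact hε⟩
    · exact ⟨min b γ.duration, min_le_right _ _, by rw [γ.path_min, hpath, dist_self]; exact hε⟩
  exact LoewnerCurve.ext (NNReal.coe_injective hdur.symm) (funext hpath)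

/-- A strictly increasing continuous function fixing `0` and `1` restricts to an increasing
homeomorphism of `[0, 1]`. -/
theorem exists_orderIso_of_strictMono {τ : ℝ≥0 → ℝ≥0} (hc : Continuous τ) (hm : StrictMono τ)
    (h0 : τ 0 = 0) (h1 : τ 1 = 1) :
    ∃ e : Icc (0 : ℝ≥0) 1 ≃o Icc (0 : ℝ≥0) 1, ∀ r, (e r : ℝ≥0) = τ r := by
  let F : Icc (0 : ℝ≥0) 1 → Icc (0 : ℝ≥0) 1 := fun r =>
    ⟨τ r, zero_le, (hm.monotone r.2.2).trans h1.le⟩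
  have hF : StrictMono F := fun a b hab => hm hab
  have hs : Function.Surjective F := by
    rintro ⟨y, hy⟩
    obtain ⟨x, hx, hxy⟩ := intermediate_value_Icc (zero_le (a := (1 : ℝ≥0))) hc.continuousOn
      (show y ∈ Icc (τ 0) (τ 1) by rwa [h0, h1])
    exact ⟨⟨x, hx⟩, Subtype.ext hxy⟩
  exact ⟨hF.orderIsoOfSurjective F hs, fun r => rfl⟩

/-- The time change `r ↦ min (r S / T) 1` would reproduce the stopped pairing exactly, but it is not
injective in general; a convex combination with the identity is, at arbitrarily small cost. -/
theorem distUnparam_le_distCap_of_duration_le {γ η : LoewnerCurve c}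
    (h : γ.duration ≤ η.duration) : distUnparam γ η ≤ distCap γ η := by
  rcases eq_or_ne γ.duration 0 with h0 | h0
  · refine (iInf_le _ (OrderIso.refl _)).trans (iSup_le fun s => ?_)
    have h1 : γ.path (s * γ.duration) = γ.path (s * η.duration) := by
      rw [← γ.path_min (s * η.duration), h0, mul_zero, min_zero]
    rw [h1]
    exact le_iSup (fun t => edist (c.unif (γ.path t)) (c.unif (η.path t))) (s * η.duration)
  · refine ENNReal.le_of_forall_pos_le_add fun ε hε _ => ?_
    set T := γ.duration
    set S := η.duration
    have hT : 0 < T := pos_iff_ne_zero.2 h0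
    obtain ⟨δ, hδ, hγδ⟩ := γ.exists_dist_path_lt (NNReal.coe_pos.2 hε)
    -- The weight `θ` of the identity displaces times on `γ` by at most `θ * T`.
    obtain ⟨θ, hθ0, hθ⟩ : ∃ θ : ℝ≥0, 0 < θ ∧ θ < 1 ∧ (θ : ℝ) * T < δ := by
      have hδT : 0 < δ / T := div_pos hδ (NNReal.coe_pos.2 hT)
      refine ⟨min (1 / 2) (Real.toNNReal (δ / T / 2)), by positivity, ?_, ?_⟩
      · exact (min_le_left _ _).trans_lt (by norm_num)
      · rw [← lt_div_iff₀ (NNReal.coe_pos.2 hT), NNReal.coe_min, Real.coe_toNNReal _ (by positivity)]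
        exact (min_le_right _ _).trans_lt (half_lt_self hδT)
    obtain ⟨θ', hθ'⟩ : ∃ θ' : ℝ≥0, θ' + θ = 1 := ⟨1 - θ, tsub_add_cancel_of_le hθ.1.le⟩
    have hST : 1 ≤ S / T := (one_le_div hT).2 h
    obtain ⟨e, he⟩ := exists_orderIso_of_strictMono
      (τ := fun r => θ' * min (r * (S / T)) 1 + θ * r) (by fun_prop)
      (fun a b hab => add_lt_add_of_le_of_lt (by gcongr) (by gcongr))
      (by simp) (by simpa [hST] using hθ')
    refine (iInf_le _ e.symm).trans (iSup_le fun s => ?_)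
    obtain ⟨r, rfl⟩ := e.surjective s
    rw [e.symm_apply_apply]
    refine (edist_triangle _ (c.unif (γ.path (r * S))) _).trans ?_
    rw [add_comm]
    refine add_le_add (le_iSup (fun t => edist (c.unif (γ.path t)) (c.unif (η.path t))) (r * S)) ?_
    rw [edist_dist, ENNReal.ofReal_le_iff_le_toReal ENNReal.coe_ne_top, ENNReal.coe_toReal]
    refine (c.dist_unif_le (γ.path_mem _) (γ.path_mem _)).trans ?_
    rw [← γ.path_min (r * S)]
    refine (hγδ _ _ (lt_of_le_of_lt ?_ hθ.2)).le
    have h1 : ((e r : ℝ≥0) : ℝ≥0) * T = θ' * min (r * S) T + θ * (r * T) := by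
      rw [he, add_mul, mul_assoc, min_mul_of_nonneg _ _ zero_le, mul_assoc,
        div_mul_cancel₀ _ h0, one_mul, mul_assoc]
    have h2 : min ((r : ℝ≥0) * S) T = θ' * min (r * S) T + θ * min (r * S) T := by
      rw [← add_mul, hθ', one_mul]
    have h3 : (r : ℝ≥0) * T ≤ T := mul_le_of_le_one_left zero_le r.2.2
    have h4 : min ((r : ℝ≥0) * S) T ≤ T := min_le_right _ _
    rw [h1, NNReal.dist_eq]
    nth_rewrite 2 [h2]
    push_cast
    rw [add_sub_add_left_eq_sub, ← mul_sub, abs_mul, NNReal.abs_eq]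
    gcongr
    have h5 : ((r : ℝ≥0) : ℝ) * T ≤ T := by exact_mod_cast h3
    have h6 : min (((r : ℝ≥0) : ℝ) * S) T ≤ T := min_le_right _ _
    have h7 : 0 ≤ min (((r : ℝ≥0) : ℝ) * S) T := by positivity
    have h8 : 0 ≤ ((r : ℝ≥0) : ℝ) * T := by positivity
    rw [abs_le]
    constructor <;> linarith

theorem distUnparam_le_distCap (γ η : LoewnerCurve c) : distUnparam γ η ≤ distCap γ η := by
  rcases le_total γ.duration η.duration with h | h
  · exact distUnparam_le_distCap_of_duration_le h
  · refine (distUnparam_comm_le γ η).trans ((distUnparam_le_distCap_of_duration_le h).trans ?_)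
    simp only [distCap, edist_comm, le_refl]

/-- Closeness in the unparameterized metric implies closeness in the capacity-parameterized
metric. -/
theorem MemClosure.exists_distCap_le {γ : LoewnerCurve c} {T : ℝ≥0} (hγ : γ.MemClosure T) {ε : ℝ}
    (hε : 0 < ε) : ∃ δ > 0, ∀ (η : LoewnerCurve c) (S : ℝ≥0), η.MemClosure S →
      distUnparam γ η < ENNReal.ofReal δ → distCap γ η ≤ ENNReal.ofReal ε := by
  obtain ⟨M, hM, hγM⟩ := γ.exists_norm_path_le
  obtain ⟨ρ, hρ, hγρ⟩ := γ.exists_dist_path_lt (half_pos hε)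
  obtain ⟨ε₁, hε₁, htime⟩ := exists_abs_time_sub_le c (M := max M (γ.duration : ℝ))
    (lt_max_of_lt_left hM) (half_pos hρ)
  obtain ⟨δ, hδ, hinv⟩ := c.exists_dist_lt_of_dist_unif_lt hM hε₁
  refine ⟨min δ (ε / 2), by positivity, fun η S hη hd => ?_⟩
  obtain ⟨σ, hσ⟩ := iInf_lt_iff.1 hd
  have hclose : ∀ s : Icc (0 : ℝ≥0) 1, dist (c.unif (γ.path (s * γ.duration)))
      (c.unif (η.path (σ s * η.duration))) < min δ (ε / 2) := fun s =>
    edist_lt_ofReal.1 ((le_iSup (fun s : Icc (0 : ℝ≥0) 1 => edist (c.unif (γ.path (s * γ.duration)))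
      (c.unif (η.path (σ s * η.duration)))) s).trans_lt hσ)
  have hcloseE : ∀ s : Icc (0 : ℝ≥0) 1, dist (γ.path (s * γ.duration))
      (η.path (σ s * η.duration)) < ε₁ := fun s =>
    hinv _ (γ.path_mem _) _ (η.path_mem _) (hγM _) ((hclose s).trans_le (min_le_left _ _))
  have hfrac : ∀ (s : Icc (0 : ℝ≥0) 1) (A a : ℝ≥0), a ≤ s * A →
      ∃ r : Icc (0 : ℝ≥0) 1, r ≤ s ∧ r * A = a := by
    intro s A a ha
    rcases eq_or_ne A 0 with h0 | h0
    · refine ⟨s, le_rfl, ?_⟩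
      rw [h0, mul_zero] at ha ⊢
      exact (nonpos_iff_eq_zero.1 ha).symm
    · have hle : a / A ≤ s := div_le_of_le_mul₀ zero_le zero_le ha
      exact ⟨⟨a / A, zero_le, hle.trans s.2.2⟩, hle, div_mul_cancel₀ _ h0⟩
  -- The monotone `σ` matches the initial segments up to `s` and `σ s`, so their capacities, i.e.
  -- the two times, are close.
  have hts : ∀ s : Icc (0 : ℝ≥0) 1,
      |((σ s * η.duration : ℝ≥0) : ℝ) - (s * γ.duration : ℝ≥0)| < ρ := by
    intro s
    have hsγ : (s : ℝ≥0) * γ.duration ≤ γ.duration := mul_le_of_le_one_left zero_le s.2.2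
    refine (htime γ η T S hγ hη (s * γ.duration) hsγ (σ s * η.duration)
      (mul_le_of_le_one_left zero_le (σ s).2.2) ?_ (fun r => (hγM r).trans (le_max_left _ _))
      (fun a ha => ?_) (fun b hb => ?_)).trans_lt (half_lt_self hρ)
    · exact le_trans (by exact_mod_cast hsγ) (le_max_right _ _)
    · obtain ⟨r, hr, rfl⟩ := hfrac s _ a ha
      exact ⟨σ r * η.duration, by gcongr, hcloseE r⟩
    · obtain ⟨r, hr, rfl⟩ := hfrac (σ s) _ b hb
      obtain ⟨q, rfl⟩ := σ.surjective r
      exact ⟨q * γ.duration, by gcongr; exact σ.le_iff_le.1 hr, hcloseE q⟩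
  refine iSup_le fun t => ?_
  rw [← η.path_min t, edist_dist]
  refine ENNReal.ofReal_le_ofReal ?_
  -- After `η` has stopped, `s` must be `1`: then `hts` compares the two durations, which also
  -- controls `γ` between them.
  obtain ⟨s, hr, hs1⟩ : ∃ s : Icc (0 : ℝ≥0) 1, σ s * η.duration = min t η.duration ∧
      (η.duration < t → (s : ℝ≥0) = 1) := by
    rcases le_or_gt t η.duration with hle | hlt
    · obtain ⟨r, -, hr⟩ := hfrac ⟨1, zero_le, le_rfl⟩ η.duration (min t η.duration) (by simp)
      obtain ⟨s, rfl⟩ := σ.surjective r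
      exact ⟨s, hr, fun h => absurd h hle.not_gt⟩
    · obtain ⟨s, hs⟩ := σ.surjective ⟨1, zero_le, le_rfl⟩
      refine ⟨s, by rw [hs, one_mul, min_eq_right hlt.le], fun _ => le_antisymm s.2.2 ?_⟩
      have : (⟨1, zero_le, le_rfl⟩ : Icc (0 : ℝ≥0) 1) ≤ s := by
        rw [← σ.le_iff_le, hs]; exact (σ _).2.2
      exact this
  have h1 := (hclose s).trans_le (min_le_right _ _)
  have h2 : dist (γ.path t) (γ.path (s * γ.duration)) < ε / 2 := by
    rw [← γ.path_min t]
    refine hγρ _ _ ?_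
    have h3 := hts s
    rw [hr] at h3
    rw [NNReal.dist_eq]
    have hsγ : (s : ℝ) * γ.duration ≤ γ.duration :=
      mul_le_of_le_one_left γ.duration.2 (by exact_mod_cast s.2.2)
    push_cast at h3 ⊢
    rw [abs_lt] at h3 ⊢
    rcases le_or_gt t η.duration with hle | hlt
    · have hle' : (t : ℝ) ≤ η.duration := by exact_mod_cast hle
      rw [min_eq_left hle'] at h3
      rcases min_cases (t : ℝ) γ.duration with h | h <;> constructor <;> linarith
    · have hlt' : (η.duration : ℝ) < t := by exact_mod_cast hlt
      rw [min_eq_right hlt'.le, hs1 hlt, NNReal.coe_one, one_mul] at h3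
      rw [hs1 hlt, NNReal.coe_one, one_mul]
      rcases min_cases (t : ℝ) γ.duration with h | h <;> constructor <;> linarith
  rw [← hr]
  have h3 := c.dist_unif_le (γ.path_mem t) (γ.path_mem (s * γ.duration))
  linarith [dist_triangle (c.unif (γ.path t)) (c.unif (γ.path (s * γ.duration)))
    (c.unif (η.path (σ s * η.duration)))]

end LoewnerCurve

/-! ### Comparison of the topologies and conclusion. -/

namespace FiniteCapacityCurve

theorem topologyOf_le {X : Type} {m₁ m₂ : PseudoEMetricSpace X}
    (h : ∀ x, ∀ ε : ℝ, 0 < ε → ∃ δ : ℝ, 0 < δ ∧ ∀ y, m₁.edist x y < ENNReal.ofReal δ →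
      m₂.edist x y ≤ ENNReal.ofReal ε) : topologyOf m₁ ≤ topologyOf m₂ := by
  rw [le_iff_nhds]
  intro x
  rw [(@Metric.nhds_basis_eball X m₁ x).le_basis_iff (@Metric.nhds_basis_eball X m₂ x)]
  intro ε hε
  obtain ⟨ε', hε', hlt⟩ := ENNReal.lt_iff_exists_nnreal_btwn.1 hε
  obtain ⟨δ, hδ, hd⟩ := h x ε' (by exact_mod_cast hε')
  refine ⟨ENNReal.ofReal δ, ENNReal.ofReal_pos.2 hδ, fun y hy => ?_⟩
  have h1 : m₁.edist x y < ENNReal.ofReal δ := by rw [m₁.edist_comm]; exact hy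
  have h2 := hd y h1
  rw [ENNReal.ofReal_coe_nnreal, m₂.edist_comm] at h2
  exact h2.trans_lt hlt

end FiniteCapacityCurve

/-- In the radial and in the chordal case, on the space of finite-capacity curves, the
capacity-parameterized, Euclidean and unparameterized distances are metrics, and they induce the
same topology. -/
theorem mainTheorem12 (c : LoewnerCase) :
    (FiniteCapacityCurve.IsGenuineMetric (FiniteCapacityCurve.capMetric c) ∧
      FiniteCapacityCurve.IsGenuineMetric (FiniteCapacityCurve.euclMetric c) ∧
      FiniteCapacityCurve.IsGenuineMetric (FiniteCapacityCurve.unparamMetric c)) ∧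
    FiniteCapacityCurve.topologyOf (FiniteCapacityCurve.capMetric c) =
      FiniteCapacityCurve.topologyOf (FiniteCapacityCurve.euclMetric c) ∧
    FiniteCapacityCurve.topologyOf (FiniteCapacityCurve.euclMetric c) =
      FiniteCapacityCurve.topologyOf (FiniteCapacityCurve.unparamMetric c) := by
  have hEucl : ∀ γ η : FiniteCapacityCurve c, LoewnerCurve.distEucl γ.1 η.1 ≠ ⊤ := by
    intro γ η
    obtain ⟨M, -, hγ⟩ := γ.1.exists_norm_path_le
    obtain ⟨N, -, hη⟩ := η.1.exists_norm_path_le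
    refine ne_top_of_le_ne_top (ENNReal.ofReal_ne_top (r := M + N)) (iSup_le fun t => ?_)
    rw [edist_dist, dist_eq_norm]
    exact ENNReal.ofReal_le_ofReal ((norm_sub_le _ _).trans (add_le_add (hγ t) (hη t)))
  have hCE : ∀ γ η : FiniteCapacityCurve c, LoewnerCurve.distCap γ.1 η.1 ≤
      LoewnerCurve.distEucl γ.1 η.1 := fun γ η => LoewnerCurve.distCap_le_distEucl _ _
  have hUC : ∀ γ η : FiniteCapacityCurve c, LoewnerCurve.distUnparam γ.1 η.1 ≤
      LoewnerCurve.distCap γ.1 η.1 := fun γ η => LoewnerCurve.distUnparam_le_distCap _ _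
  have hzero : ∀ γ η : FiniteCapacityCurve c, LoewnerCurve.distCap γ.1 η.1 = 0 → γ = η :=
    fun γ η h => by
      obtain ⟨T, hT⟩ := γ.2
      obtain ⟨S, hS⟩ := η.2
      exact Subtype.ext (LoewnerCurve.eq_of_distCap_eq_zero hT hS h)
  have hCU : ∀ γ : FiniteCapacityCurve c, ∀ ε : ℝ, 0 < ε → ∃ δ : ℝ, 0 < δ ∧
      ∀ η : FiniteCapacityCurve c, LoewnerCurve.distUnparam γ.1 η.1 < ENNReal.ofReal δ →
        LoewnerCurve.distCap γ.1 η.1 ≤ ENNReal.ofReal ε := fun γ ε hε => by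
    obtain ⟨T, hT⟩ := γ.2
    obtain ⟨δ, hδ, h⟩ := hT.exists_distCap_le hε
    refine ⟨δ, hδ, fun η => ?_⟩
    obtain ⟨S, hS⟩ := η.2
    exact h η.1 S hS
  have hEC : ∀ γ : FiniteCapacityCurve c, ∀ ε : ℝ, 0 < ε → ∃ δ : ℝ, 0 < δ ∧
      ∀ η : FiniteCapacityCurve c, LoewnerCurve.distCap γ.1 η.1 < ENNReal.ofReal δ →
        LoewnerCurve.distEucl γ.1 η.1 ≤ ENNReal.ofReal ε := fun γ ε hε => by
    obtain ⟨δ, hδ, h⟩ := γ.1.exists_dist_path_lt_of_distCap_lt hε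
    refine ⟨δ, hδ, fun η hη => iSup_le fun t => ?_⟩
    rw [edist_dist]
    exact ENNReal.ofReal_le_ofReal (h η.1 hη t).le
  have htop : FiniteCapacityCurve.topologyOf (FiniteCapacityCurve.capMetric c) =
      FiniteCapacityCurve.topologyOf (FiniteCapacityCurve.euclMetric c) :=
    le_antisymm (FiniteCapacityCurve.topologyOf_le hEC)
      (FiniteCapacityCurve.topologyOf_le fun γ ε hε => ⟨ε, hε, fun η h => (hCE γ η).trans h.le⟩)
  refine ⟨⟨fun γ η => ⟨ne_top_of_le_ne_top (hEucl γ η) (hCE γ η), hzero γ η⟩,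
    fun γ η => ⟨hEucl γ η, fun h => hzero γ η (nonpos_iff_eq_zero.1 ((hCE γ η).trans h.le))⟩,
    fun γ η => ⟨ne_top_of_le_ne_top (hEucl γ η) ((hUC γ η).trans (hCE γ η)), fun h => ?_⟩⟩,
    htop, htop.symm.trans (le_antisymm
      (FiniteCapacityCurve.topologyOf_le fun γ ε hε => ⟨ε, hε, fun η h => (hUC γ η).trans h.le⟩)
      (FiniteCapacityCurve.topologyOf_le hCU))⟩
  -- A vanishing `distUnparam` is below every `δ` supplied by `hCU`, so `distCap` is below every
  -- `ε`.
  refine hzero γ η (nonpos_iff_eq_zero.1 (ENNReal.le_of_forall_pos_le_add fun ε hε _ => ?_))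
  obtain ⟨δ, hδ, h'⟩ := hCU γ ε (NNReal.coe_pos.2 hε)
  rw [zero_add, ← ENNReal.ofReal_coe_nnreal]
  refine h' η ?_
  change LoewnerCurve.distUnparam γ.1 η.1 = 0 at h
  rw [h]
  exact ENNReal.ofReal_pos.2 hδ
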